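/- **Conventions.** $\otimes$ is the minimal (spatial) tensor product of $C^*$-algebras and $M(A)$ is the multiplier algebra of a $C^*$-algebra $A$. A $*$-homomorphism $f\colon A\to M(B)$ is *non-degenerate* if $f(A)B$ spans a dense subspace of $B$; it then extends uniquely to a unital $*$-homomorphism $M(A)\to M(B)$, again denoted by $f$. $C^*$-algebras may be zero. **Locally compact quantum groups.** A locally compact quantum group $\mathbb G$ is a $C^*$-algebra $C=C_0(\mathbb G)$ with a non-degenerate $*$-homomorphism $\Delta\colon C\to M(C\otimes C)$ such that $(\Delta\otimes\mathrm{id})\Delta=(\mathrm{id}\otimes\Delta)\Delta$; the sets $\{(\omega\otimes\mathrm{id})\Delta(a)\mid\omega\in C^*,a\in C\}$ and $\{(\mathrm{id}\otimes\omega)\Delta(a)\mid\omega\in C^*,a\in C\}$ are contained in $C$ and span dense subspaces of $C$; and there exist a left-invariant and a right-invariant approximate KMS weight on $C$. Here a weight is *approximate KMS* if it is non-zero, densely defined and lower semicontinuous, and its lift to the von Neumann algebra generated by its GNS representation is faithful. A weight $\varphi$ is *left invariant* if $\varphi((\omega\otimes\mathrm{id})\Delta(a))=\|\omega\|\,\varphi(a)$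 for all positive $\omega\in C^*$ and positive $a\in C$ with $\varphi(a)<\infty$; right invariance is the same with $(\mathrm{id}\otimes\omega)\Delta(a)$. **Actions.** An *action* of $\mathbb G$ on a $C^*$-algebra $A$ is a non-degenerate $*$-homomorphism $\rho\colon A\to M(C\otimes A)$ such that $(\mathrm{id}\otimes\rho)\rho=(\Delta\otimes\mathrm{id})\rho$ as maps $A\to M(C\otimes C\otimes A)$; $\rho(A)(C\otimes 1)$ and $(C\otimes 1)\rho(A)$ are contained in $C\otimes A$; and $\rho(A)(C\otimes1)$ spans a dense subspace of $C\otimes A$. **Equivariance.** For actions $\rho_A$, $\rho_B$ of $\mathbb G$ on $A$, $B$, a (possibly degenerate) $*$-homomorphism $f\colon A\to M(B)$ is *equivariant* if $\rho_B\circ f=(\mathrm{id}\otimes f)\circ\rho_A$ as maps $A\to M(C\otimes B)$. Here, for $x\in M(C\otimes A)$ with $x(C\otimes1)\cup(C\otimes 1)x\subseteq C\otimes A$, the multiplier $(\mathrm{id}\otimes f)(x)$ is the one determined by $(\mathrm{id}\otimes f)(x)\,(c\otimes1)=(\mathrm{id}\otimes f)(x(c\otimes1))$ for $c\in C$. **Equivariant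 compactifications.** Let $\rho$ be an action of $\mathbb G$ on $A$. The category $\mathrm{cpct}(\rho)$ has as objects the quadruples $(B,\ell,r,\rho_B)$, where $B$ is a unital $C^*$-algebra, $\rho_B$ is an action of $\mathbb G$ on $B$, $\ell\colon A\to B$ is an equivariant $*$-homomorphism and $r\colon B\to M(A)$ is an equivariant unital $*$-homomorphism such that $r\circ\ell$ is the canonical inclusion $A\subseteq M(A)$, itself equivariant. A morphism $(B,\ell,r,\rho_B)\to(B',\ell',r',\rho_{B'})$ is an equivariant unital $*$-homomorphism $f\colon B\to B'$ with $f\circ\ell=\ell'$ and $r'\circ f=r$. **Theorem.** For every action $\rho$ of a locally compact quantum group on a $C^*$-algebra, the category $\mathrm{cpct}(\rho)$ has a terminal object. (This terminal object is the greatest equivariant compactification of $\rho$; when $\rho$ is the regular action $\Delta\colon C\to M(C\otimes C)$ of $\mathbb G$ on $C$, it is called the greatest ambit of $\mathbb G$.) -/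

import Mathlib

open scoped TensorProduct MultiplierAlgebra InnerProductSpace ENNReal

universe u

set_option linter.unusedSectionVars false
set_option linter.unusedVariables false

noncomputable section

namespace QuantumCompactification

section HilbertTensor

variable {H K : Type*} [NormedAddCommGroup H] [InnerProductSpace ℂ H]
  [NormedAddCommGroup K] [InnerProductSpace ℂ K]

/-- The Hilbert space tensor product. -/
def HilbertTensor (H K : Type*) [NormedAddCommGroup H] [InnerProductSpace ℂ H]
    [NormedAddCommGroup K] [InnerProductSpace ℂ K] : Type _ :=
  UniformSpace.Completion (H ⊗[ℂ] K)

instance : NormedAddCommGroup (HilbertTensor H K) :=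
  inferInstanceAs (NormedAddCommGroup (UniformSpace.Completion (H ⊗[ℂ] K)))

instance : InnerProductSpace ℂ (HilbertTensor H K) :=
  inferInstanceAs (InnerProductSpace ℂ (UniformSpace.Completion (H ⊗[ℂ] K)))

instance : CompleteSpace (HilbertTensor H K) :=
  inferInstanceAs (CompleteSpace (UniformSpace.Completion (H ⊗[ℂ] K)))

/-- The inclusion of the algebraic tensor product as a dense subspace. -/
def hilbertEmb : (H ⊗[ℂ] K) →ₗᵢ[ℂ] HilbertTensor H K :=
  UniformSpace.Completion.toComplₗᵢ

theorem denseRange_hilbertEmb : DenseRange (hilbertEmb : (H ⊗[ℂ] K) →ₗᵢ[ℂ] HilbertTensor H K) :=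
  UniformSpace.Completion.denseRange_coe

/-- The bounded operator `S ⊗ T` on the Hilbert space tensor product. -/
def opTensor (S : H →L[ℂ] H) (T : K →L[ℂ] K) : HilbertTensor H K →L[ℂ] HilbertTensor H K :=
  (TensorProduct.mapL S T).completion

theorem opTensor_emb (S : H →L[ℂ] H) (T : K →L[ℂ] K) (x : H ⊗[ℂ] K) :
    opTensor S T (hilbertEmb x) = hilbertEmb (TensorProduct.mapL S T x) :=
  ContinuousLinearMap.completion_apply_coe _ x

theorem opTensor_tmul (S : H →L[ℂ] H) (T : K →L[ℂ] K) (h : H) (k : K) :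
    opTensor S T (hilbertEmb (h ⊗ₜ[ℂ] k)) = hilbertEmb (S h ⊗ₜ[ℂ] T k) := by
  rw [opTensor_emb, TensorProduct.mapL_tmul]

/-- Bounded operators that agree on elementary tensors agree. -/
theorem op_ext {E : Type*} [NormedAddCommGroup E] [NormedSpace ℂ E]
    {S T : HilbertTensor H K →L[ℂ] E}
    (h : ∀ (x : H) (y : K), S (hilbertEmb (x ⊗ₜ[ℂ] y)) = T (hilbertEmb (x ⊗ₜ[ℂ] y))) :
    S = T := by
  ext z
  refine denseRange_hilbertEmb.induction_on (p := fun z => S z = T z) z ?_ fun x => ?_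
  · apply isClosed_eq <;> fun_prop
  · induction x using TensorProduct.induction_on with
    | zero => simp
    | tmul x y => exact h x y
    | add x y hx hy => rw [map_add, map_add, map_add, hx, hy]

theorem norm_opTensor_le (S : H →L[ℂ] H) (T : K →L[ℂ] K) :
    ‖opTensor S T‖ ≤ ‖S‖ * ‖T‖ := by
  refine ContinuousLinearMap.opNorm_le_bound _ (by positivity) fun x => ?_
  refine denseRange_hilbertEmb.induction_on
    (p := fun x => ‖opTensor S T x‖ ≤ ‖S‖ * ‖T‖ * ‖x‖) x ?_ fun x => ?_
  · apply isClosed_le <;> fun_prop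
  · rw [opTensor_emb, LinearIsometry.norm_map, LinearIsometry.norm_map]
    exact (TensorProduct.mapL S T).le_of_opNorm_le (TensorProduct.norm_mapL_le S T) x

variable [CompleteSpace H] [CompleteSpace K]

theorem opTensor_star (S : H →L[ℂ] H) (T : K →L[ℂ] K) :
    star (opTensor S T) = opTensor (star S) (star T) := by
  symm
  refine (ContinuousLinearMap.eq_adjoint_iff _ _).mpr fun x y => ?_
  refine denseRange_hilbertEmb.induction_on₂
    (p := fun x y => ⟪opTensor (star S) (star T) x, y⟫_ℂ = ⟪x, opTensor S T y⟫_ℂ) ?_ ?_ x y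
  · apply isClosed_eq <;> fun_prop
  · intro x y
    simp only [opTensor_emb, LinearIsometry.inner_map_map, TensorProduct.mapL_apply]
    induction x using TensorProduct.induction_on with
    | zero => simp
    | add x₁ x₂ h₁ h₂ => rw [map_add, inner_add_left, inner_add_left, h₁, h₂]
    | tmul a b =>
      induction y using TensorProduct.induction_on with
      | zero => simp
      | add y₁ y₂ h₁ h₂ => rw [inner_add_right, map_add, inner_add_right, h₁, h₂]
      | tmul c d =>
        simp [ContinuousLinearMap.star_eq_adjoint, ContinuousLinearMap.adjoint_inner_left]

end HilbertTensor

section AlgTensor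

variable {A B D : Type*} [NonUnitalRing A] [StarRing A] [Module ℂ A] [IsScalarTower ℂ A A]
  [SMulCommClass ℂ A A] [StarModule ℂ A]
  [NonUnitalRing B] [StarRing B] [Module ℂ B] [IsScalarTower ℂ B B]
  [SMulCommClass ℂ B B] [StarModule ℂ B]
  [NonUnitalRing D] [StarRing D] [Module ℂ D] [IsScalarTower ℂ D D]
  [SMulCommClass ℂ D D] [StarModule ℂ D]

/-- A bilinear map that is multiplicative and `*`-preserving on elementary tensors induces a
`*`-homomorphism on the algebraic tensor product. -/
def algLift (β : A →ₗ[ℂ] B →ₗ[ℂ] D)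
    (hmul : ∀ a a' b b', β (a * a') (b * b') = β a b * β a' b')
    (hstar : ∀ a b, β (star a) (star b) = star (β a b)) : (A ⊗[ℂ] B) →⋆ₙₐ[ℂ] D where
  toFun := TensorProduct.lift β
  map_smul' c x := by simp
  map_zero' := by simp
  map_add' x y := by simp
  map_mul' x y := by
    induction x using TensorProduct.induction_on with
    | zero => simp
    | add x₁ x₂ h₁ h₂ => simp only [add_mul, map_add, h₁, h₂]
    | tmul a b =>
      induction y using TensorProduct.induction_on with
      | zero => simp
      | add y₁ y₂ h₁ h₂ => simp only [mul_add, map_add, h₁, h₂]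
      | tmul c d => simp [hmul]
  map_star' x := by
    induction x using TensorProduct.induction_on with
    | zero => simp
    | add x₁ x₂ h₁ h₂ => simp only [star_add, map_add, h₁, h₂]
    | tmul a b => simp [hstar]

@[simp] theorem algLift_tmul (β : A →ₗ[ℂ] B →ₗ[ℂ] D) (hmul hstar) (a : A) (b : B) :
    algLift β hmul hstar (a ⊗ₜ[ℂ] b) = β a b := rfl

end AlgTensor

section ProdRep

variable {A B : Type*} [NonUnitalCStarAlgebra A] [NonUnitalCStarAlgebra B]
variable {H K : Type*} [NormedAddCommGroup H] [InnerProductSpace ℂ H] [CompleteSpace H]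
  [NormedAddCommGroup K] [InnerProductSpace ℂ K] [CompleteSpace K]

/-- The representation `π ⊗ σ` of the algebraic tensor product on the Hilbert space tensor
product. -/
def prodRep (π : A →⋆ₙₐ[ℂ] (H →L[ℂ] H)) (σ : B →⋆ₙₐ[ℂ] (K →L[ℂ] K)) :
    (A ⊗[ℂ] B) →⋆ₙₐ[ℂ] (HilbertTensor H K →L[ℂ] HilbertTensor H K) :=
  algLift
    (LinearMap.mk₂ ℂ (fun a b => opTensor (π a) (σ b))
      (fun a a' b => op_ext fun x y => by
        simp [opTensor_tmul, TensorProduct.add_tmul])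
      (fun c a b => op_ext fun x y => by
        simp [opTensor_tmul, ← TensorProduct.smul_tmul'])
      (fun a b b' => op_ext fun x y => by
        simp [opTensor_tmul, TensorProduct.tmul_add])
      (fun c a b => op_ext fun x y => by
        simp [opTensor_tmul]))
    (fun a a' b b' => op_ext fun x y => by simp [opTensor_tmul])
    (fun a b => by simp only [LinearMap.mk₂_apply, opTensor_star, map_star])

@[simp] theorem prodRep_tmul (π : A →⋆ₙₐ[ℂ] (H →L[ℂ] H)) (σ : B →⋆ₙₐ[ℂ] (K →L[ℂ] K))
    (a : A) (b : B) : prodRep π σ (a ⊗ₜ[ℂ] b) = opTensor (π a) (σ b) := rfl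

end ProdRep

/-- A representation of a C*-algebra on a Hilbert space. -/
structure Rep (A : Type u) [NonUnitalCStarAlgebra A] where
  H : Type u
  [grp : NormedAddCommGroup H]
  [ips : InnerProductSpace ℂ H]
  [cpl : CompleteSpace H]
  π : A →⋆ₙₐ[ℂ] (H →L[ℂ] H)

attribute [instance] Rep.grp Rep.ips Rep.cpl

section Spatial

variable (A B : Type u) [NonUnitalCStarAlgebra A] [NonUnitalCStarAlgebra B]

/-- The seminorms `x ↦ ‖(π ⊗ σ)(x)‖` on the algebraic tensor product, for `π`, `σ` ranging over
all representations of `A` and of `B`. They are used as a small index set. -/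
def SpatialIndex : Type u :=
  {p : A ⊗[ℂ] B → ℝ // ∃ (R : Rep A) (S : Rep B), p = fun x => ‖prodRep R.π S.π x‖}

variable {A B}

def SpatialIndex.left (p : SpatialIndex A B) : Rep A := p.2.choose

def SpatialIndex.right (p : SpatialIndex A B) : Rep B := p.2.choose_spec.choose

theorem SpatialIndex.spec (p : SpatialIndex A B) (x : A ⊗[ℂ] B) :
    p.1 x = ‖prodRep p.left.π p.right.π x‖ :=
  congrFun p.2.choose_spec.choose_spec x

theorem exists_norm_prodRep_le (x : A ⊗[ℂ] B) :
    ∃ C : ℝ, ∀ (R : Rep A) (S : Rep B), ‖prodRep R.π S.π x‖ ≤ C := by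
  induction x using TensorProduct.induction_on with
  | zero => exact ⟨0, fun R S => by simp⟩
  | tmul a b =>
    refine ⟨‖a‖ * ‖b‖, fun R S => ?_⟩
    rw [prodRep_tmul]
    refine (norm_opTensor_le _ _).trans ?_
    gcongr
    · exact NonUnitalStarAlgHom.norm_apply_le R.π a
    · exact NonUnitalStarAlgHom.norm_apply_le S.π b
  | add x y hx hy =>
    obtain ⟨C, hC⟩ := hx
    obtain ⟨D, hD⟩ := hy
    exact ⟨C + D, fun R S => by
      rw [map_add]; exact (norm_add_le _ _).trans (add_le_add (hC R S) (hD R S))⟩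

variable (A B)

/-- The bounded operators on `H_π ⊗ H_σ`, for all (classes of) pairs `(π, σ)`. -/
def SpatialAmbient : Type u :=
  lp (fun p : SpatialIndex A B =>
    HilbertTensor p.left.H p.right.H →L[ℂ] HilbertTensor p.left.H p.right.H) ∞

instance : NonUnitalCStarAlgebra (SpatialAmbient A B) :=
  inferInstanceAs (NonUnitalCStarAlgebra (lp (fun p : SpatialIndex A B =>
    HilbertTensor p.left.H p.right.H →L[ℂ] HilbertTensor p.left.H p.right.H) ∞))

/-- The `*`-homomorphism `x ↦ ((π ⊗ σ)(x))_{π, σ}`. -/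
def spatialHom : (A ⊗[ℂ] B) →⋆ₙₐ[ℂ] SpatialAmbient A B where
  toFun x := ⟨fun p => prodRep p.left.π p.right.π x, by
    obtain ⟨C, hC⟩ := exists_norm_prodRep_le x
    exact memℓp_infty ⟨C, by rintro _ ⟨p, rfl⟩; exact hC _ _⟩⟩
  map_smul' c x := Subtype.ext <| funext fun p => map_smul (prodRep p.left.π p.right.π) c x
  map_zero' := Subtype.ext <| funext fun p => map_zero (prodRep p.left.π p.right.π)
  map_add' x y := Subtype.ext <| funext fun p => map_add (prodRep p.left.π p.right.π) x y
  map_mul' x y := Subtype.ext <| funext fun p => map_mul (prodRep p.left.π p.right.π) x y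
  map_star' x := Subtype.ext <| funext fun p => map_star (prodRep p.left.π p.right.π) x

/-- The minimal (spatial) tensor product of two C*-algebras: the closure of the image of the
algebraic tensor product under the sum of all `π ⊗ σ`, that is, its completion for the norm
`‖x‖ = sup_{π, σ} ‖(π ⊗ σ)(x)‖`. -/
def SpatialTensor : Type u :=
  ↥(NonUnitalStarAlgHom.range (spatialHom A B)).topologicalClosure

instance : NonUnitalCStarAlgebra (SpatialTensor A B) :=
  NonUnitalStarSubalgebra.nonUnitalCStarAlgebra
    (NonUnitalStarAlgHom.range (spatialHom A B)).topologicalClosure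
    (h_closed := NonUnitalStarSubalgebra.isClosed_topologicalClosure _)

infixr:70 " ⊗ₛ " => SpatialTensor

variable {A B}

/-- The canonical map from the algebraic to the spatial tensor product. -/
def ofAlg : (A ⊗[ℂ] B) →⋆ₙₐ[ℂ] A ⊗ₛ B where
  toFun x := ⟨spatialHom A B x, NonUnitalStarSubalgebra.le_topologicalClosure _ ⟨x, rfl⟩⟩
  map_smul' c x := Subtype.ext (map_smul (spatialHom A B) c x)
  map_zero' := Subtype.ext (map_zero (spatialHom A B))
  map_add' x y := Subtype.ext (map_add (spatialHom A B) x y)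
  map_mul' x y := Subtype.ext (map_mul (spatialHom A B) x y)
  map_star' x := Subtype.ext (map_star (spatialHom A B) x)

/-- The elementary tensor `a ⊗ b` in `A ⊗ B`. -/
def tmul (a : A) (b : B) : A ⊗ₛ B := ofAlg (a ⊗ₜ[ℂ] b)

theorem denseRange_ofAlg : DenseRange (ofAlg : (A ⊗[ℂ] B) →⋆ₙₐ[ℂ] A ⊗ₛ B) := by
  intro y
  have key : Subtype.val '' Set.range (ofAlg : (A ⊗[ℂ] B) →⋆ₙₐ[ℂ] A ⊗ₛ B) =
      (NonUnitalStarAlgHom.range (spatialHom A B) : Set (SpatialAmbient A B)) := by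
    ext z
    constructor
    · rintro ⟨_, ⟨x, rfl⟩, rfl⟩; exact ⟨x, rfl⟩
    · rintro ⟨x, rfl⟩; exact ⟨_, ⟨x, rfl⟩, rfl⟩
  have hy : (y.1 : SpatialAmbient A B) ∈
      closure (Subtype.val '' Set.range (ofAlg : (A ⊗[ℂ] B) →⋆ₙₐ[ℂ] A ⊗ₛ B)) := by
    rw [key]; exact y.2
  exact closure_subtype.mpr hy

theorem norm_ofAlg_le {x : A ⊗[ℂ] B} {C : ℝ} (hC : 0 ≤ C)
    (h : ∀ (R : Rep A) (S : Rep B), ‖prodRep R.π S.π x‖ ≤ C) : ‖ofAlg x‖ ≤ C :=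
  lp.norm_le_of_forall_le (f := spatialHom A B x) hC fun p => h p.left p.right

theorem norm_prodRep_le (R : Rep A) (S : Rep B) (x : A ⊗[ℂ] B) :
    ‖prodRep R.π S.π x‖ ≤ ‖ofAlg x‖ := by
  let p : SpatialIndex A B := ⟨fun x => ‖prodRep R.π S.π x‖, R, S, rfl⟩
  have := p.spec x
  change ‖prodRep R.π S.π x‖ = _ at this
  rw [this]
  exact lp.norm_apply_le_norm ENNReal.top_ne_zero (spatialHom A B x) p

end Spatial

section Lift

variable {X P Q : Type*} [NonUnitalRing X] [StarRing X] [Module ℂ X]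
  [NonUnitalCStarAlgebra P] [NonUnitalCStarAlgebra Q]

/-- Extension of a bounded `*`-homomorphism from a dense `*`-subalgebra. -/
def liftHom (i : X →⋆ₙₐ[ℂ] P) (hi : DenseRange i) (Φ : X →⋆ₙₐ[ℂ] Q)
    (h : ∀ x, ‖Φ x‖ ≤ ‖i x‖) : P →⋆ₙₐ[ℂ] Q :=
  let F : P →L[ℂ] Q := LinearMap.extendOfNorm (Φ : X →ₗ[ℂ] Q) (i : X →ₗ[ℂ] P)
  have hF : ∀ x, F (i x) = Φ x := fun x =>
    LinearMap.extendOfNorm_eq hi ⟨1, fun x => by simpa using h x⟩ x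
  { toFun := F
    map_smul' := fun c x => map_smul F c x
    map_zero' := map_zero F
    map_add' := map_add F
    map_mul' := fun x y => by
      refine hi.induction_on₂ (p := fun x y => F (x * y) = F x * F y) ?_ ?_ x y
      · apply isClosed_eq <;> fun_prop
      · intro x y; rw [← map_mul, hF, hF, hF, map_mul]
    map_star' := fun x => by
      refine hi.induction_on (p := fun x => F (star x) = star (F x)) x ?_ ?_
      · apply isClosed_eq <;> fun_prop
      · intro x; rw [← map_star, hF, hF, map_star] }

theorem liftHom_apply (i : X →⋆ₙₐ[ℂ] P) (hi : DenseRange i) (Φ : X →⋆ₙₐ[ℂ] Q)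
    (h : ∀ x, ‖Φ x‖ ≤ ‖i x‖) (x : X) : liftHom i hi Φ h (i x) = Φ x :=
  LinearMap.extendOfNorm_eq (f := (Φ : X →ₗ[ℂ] Q)) (e := (i : X →ₗ[ℂ] P)) hi
    ⟨1, fun x => by simpa using h x⟩ x

end Lift

section Map

variable {A B C D E : Type u} [NonUnitalCStarAlgebra A] [NonUnitalCStarAlgebra B]
  [NonUnitalCStarAlgebra C] [NonUnitalCStarAlgebra D] [NonUnitalCStarAlgebra E]

theorem star_hom_continuous {P Q : Type*} [NonUnitalCStarAlgebra P] [NonUnitalCStarAlgebra Q]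
    (f : P →⋆ₙₐ[ℂ] Q) : Continuous f :=
  AddMonoidHomClass.continuous_of_bound f 1 fun x => by
    simpa using NonUnitalStarAlgHom.norm_apply_le f x

/-- Continuous linear maps that agree on elementary tensors agree. -/
theorem tensor_ext {E : Type*} [NormedAddCommGroup E] [NormedSpace ℂ E] {S T : A ⊗ₛ B →L[ℂ] E}
    (h : ∀ a b, S (tmul a b) = T (tmul a b)) : S = T := by
  ext z
  refine denseRange_ofAlg.induction_on (p := fun z => S z = T z) z ?_ fun x => ?_
  · apply isClosed_eq <;> fun_prop
  · induction x using TensorProduct.induction_on with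
    | zero => simp
    | tmul x y => exact h x y
    | add x y hx hy => rw [map_add, map_add, map_add, hx, hy]

/-- `f ⊗ g` on algebraic tensor products. -/
def algMap (f : A →⋆ₙₐ[ℂ] C) (g : B →⋆ₙₐ[ℂ] D) : (A ⊗[ℂ] B) →⋆ₙₐ[ℂ] (C ⊗[ℂ] D) :=
  algLift ((TensorProduct.mk ℂ C D).compl₁₂ (f : A →ₗ[ℂ] C) (g : B →ₗ[ℂ] D))
    (fun a a' b b' => by simp) (fun a b => by simp [map_star])

@[simp] theorem algMap_tmul (f : A →⋆ₙₐ[ℂ] C) (g : B →⋆ₙₐ[ℂ] D) (a : A) (b : B) :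
    algMap f g (a ⊗ₜ[ℂ] b) = f a ⊗ₜ[ℂ] g b := rfl

theorem prodRep_algMap (f : A →⋆ₙₐ[ℂ] C) (g : B →⋆ₙₐ[ℂ] D) (R : Rep C) (S : Rep D)
    (x : A ⊗[ℂ] B) :
    prodRep R.π S.π (algMap f g x) = prodRep (R.π.comp f) (S.π.comp g) x := by
  induction x using TensorProduct.induction_on with
  | zero => rw [map_zero, map_zero, map_zero]
  | tmul x y => rfl
  | add x y hx hy => rw [map_add, map_add, map_add, hx, hy]

/-- The functoriality `f ⊗ g : A ⊗ B → C ⊗ D` of the spatial tensor product. -/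
def tensorMap (f : A →⋆ₙₐ[ℂ] C) (g : B →⋆ₙₐ[ℂ] D) : A ⊗ₛ B →⋆ₙₐ[ℂ] C ⊗ₛ D :=
  liftHom ofAlg denseRange_ofAlg (ofAlg.comp (algMap f g)) fun x =>
    norm_ofAlg_le (norm_nonneg _) fun R S =>
      (congrArg norm (prodRep_algMap f g R S x)).trans_le
        (norm_prodRep_le ⟨R.H, R.π.comp f⟩ ⟨S.H, S.π.comp g⟩ x)

theorem tensorMap_tmul (f : A →⋆ₙₐ[ℂ] C) (g : B →⋆ₙₐ[ℂ] D) (a : A) (b : B) :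
    tensorMap f g (tmul a b) = tmul (f a) (g b) :=
  liftHom_apply _ _ _ _ (a ⊗ₜ[ℂ] b)

end Map

section Core

open Filter Topology

/-- Vectors moved by, or killed by, an algebra of operators. -/
def actionSpan {A X : Type*} [NonUnitalCStarAlgebra A] [NormedAddCommGroup X] [NormedSpace ℂ X]
    (π : A →ₗ[ℂ] (X →L[ℂ] X)) : Submodule ℂ X :=
  Submodule.span ℂ ({y | ∃ a x, π a x = y} ∪ {y | ∀ a, π a y = 0})

/-- An action of a C*-algebra on a Banach space extends to multipliers. -/
theorem exists_multiplier_action {A X : Type*} [NonUnitalCStarAlgebra A] [NormedAddCommGroup X]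
    [NormedSpace ℂ X] [CompleteSpace X] (π : A →ₗ[ℂ] (X →L[ℂ] X))
    (hmul : ∀ a b x, π (a * b) x = π a (π b x)) (hb : ∀ a, ‖π a‖ ≤ ‖a‖)
    (hd : Dense (actionSpan π : Set X)) (m : 𝓜(ℂ, A)) :
    ∃ T : X →L[ℂ] X, (∀ a x, T (π a x) = π (m.fst a) x) ∧ ∀ y, (∀ a, π a y = 0) → T y = 0 := by
  let _ := CStarAlgebra.spectralOrder A
  have _ := CStarAlgebra.spectralOrderedRing A
  set l := CStarAlgebra.approximateUnit A with hl
  have hl' := CStarAlgebra.increasingApproximateUnit A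
  have hπ : Continuous π := AddMonoidHomClass.continuous_of_bound π 1 fun a => by simpa using hb a
  have h1 : ∀ a x, Tendsto (fun e => π (m.fst e) (π a x)) l (𝓝 (π (m.fst a) x)) := by
    intro a x
    have e1 : ∀ e, π (m.fst e) (π a x) = π (m.fst (e * a)) x := by
      intro e
      rw [← hmul]
      congr 2
      have : ∀ c : A, c * (m.fst e * a) = c * m.fst (e * a) := fun c => by
        rw [← mul_assoc, ← m.central, mul_assoc, m.central]
      have h0 : star (m.fst e * a - m.fst (e * a)) * (m.fst e * a - m.fst (e * a)) = 0 := by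
        rw [mul_sub, this, sub_self]
      exact sub_eq_zero.mp (CStarRing.star_mul_self_eq_zero_iff _ |>.mp h0)
    simp only [e1]
    have : Continuous fun c => π (m.fst c) x := by fun_prop
    exact (this.tendsto a).comp (hl'.tendsto_mul_right a)
  have h2 : ∀ y, (∀ a, π a y = 0) → Tendsto (fun e => π (m.fst e) y) l (𝓝 0) := by
    intro y hy; simp [hy]
  let V : Submodule ℂ X :=
    { carrier := {x | ∃ y, Tendsto (fun e => π (m.fst e) x) l (𝓝 y)}
      add_mem' := by
        rintro x y ⟨a, ha⟩ ⟨b, hb⟩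
        exact ⟨a + b, by simpa using ha.add hb⟩
      zero_mem' := ⟨0, by simp⟩
      smul_mem' := by
        rintro c x ⟨a, ha⟩
        exact ⟨c • a, by simpa using ha.const_smul c⟩ }
  have hV : actionSpan π ≤ V := by
    refine Submodule.span_le.mpr ?_
    rintro y (⟨a, x, rfl⟩ | hy)
    · exact ⟨_, h1 a x⟩
    · exact ⟨0, h2 y hy⟩
  have hex : ∀ v : V, ∃ y, Tendsto (fun e => π (m.fst e) (v : X)) l (𝓝 y) := fun v => v.2
  choose g hg using hex
  let G : V →ₗ[ℂ] X :=
    { toFun := g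
      map_add' := fun v w => tendsto_nhds_unique (hg (v + w)) (by simpa using (hg v).add (hg w))
      map_smul' := fun c v =>
        tendsto_nhds_unique (hg (c • v)) (by simpa using (hg v).const_smul c) }
  have hGb : ∀ v : V, ‖G v‖ ≤ ‖m‖ * ‖V.subtype v‖ := by
    intro v
    refine le_of_tendsto (hg v).norm ?_
    filter_upwards [hl'.eventually_norm] with e he
    calc ‖π (m.fst e) (v : X)‖ ≤ ‖π (m.fst e)‖ * ‖(v : X)‖ := ContinuousLinearMap.le_opNorm _ _
      _ ≤ ‖m‖ * ‖(v : X)‖ := by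
        gcongr
        calc ‖π (m.fst e)‖ ≤ ‖m.fst e‖ := hb _
          _ ≤ ‖m.fst‖ * ‖e‖ := ContinuousLinearMap.le_opNorm _ _
          _ ≤ ‖m‖ * 1 := by rw [DoubleCentralizer.norm_fst]; gcongr
          _ = ‖m‖ := mul_one _
  have hdr : DenseRange V.subtype := by
    refine Dense.mono ?_ hd
    intro x hx
    exact ⟨⟨x, hV hx⟩, rfl⟩
  have hT : ∀ v : V, G.extendOfNorm V.subtype (v : X) = g v := fun v =>
    LinearMap.extendOfNorm_eq hdr ⟨‖m‖, hGb⟩ v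
  refine ⟨G.extendOfNorm V.subtype, fun a x => ?_, fun y hy => ?_⟩
  · have hx : π a x ∈ V := ⟨_, h1 a x⟩
    exact (hT ⟨_, hx⟩).trans (tendsto_nhds_unique (hg ⟨_, hx⟩) (h1 a x))
  · have hx : y ∈ V := ⟨_, h2 y hy⟩
    exact (hT ⟨_, hx⟩).trans (tendsto_nhds_unique (hg ⟨_, hx⟩) (h2 y hy))

end Core

section Multiplier

variable {A B : Type*} [NonUnitalCStarAlgebra A] [NonUnitalCStarAlgebra B]

/-- A multiplier is determined by its left action. -/
theorem mult_ext {x y : 𝓜(ℂ, A)} (h : ∀ a, x.fst a = y.fst a) : x = y := by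
  have : (x - y).fst = 0 := by
    ext a; simp [h]
  rw [← sub_eq_zero, ← norm_eq_zero, ← DoubleCentralizer.norm_fst, this, norm_zero]

/-- The multiplier with left action `L` and adjoint `L'`. -/
def mkMult (L L' : A →L[ℂ] A) (h : ∀ x y, star (L x) * y = star x * L' y) : 𝓜(ℂ, A) where
  fst := L
  snd := LinearMap.mkContinuous
    { toFun := fun x => star (L' (star x))
      map_add' := fun x y => by simp
      map_smul' := fun c x => by simp } ‖L'‖ fun x => by
        simpa using L'.le_opNorm (star x)
  central x y := by
    have := congrArg star (h y (star x))
    simpa using this.symm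

theorem mult_central' (m : 𝓜(ℂ, A)) (x y : A) : star (m.fst x) * y = star x * (star m).fst y := by
  rw [DoubleCentralizer.star_fst]
  have := congrArg star (m.central (star y) x)
  simpa using this.symm

end Multiplier

section RepExt

variable {A : Type u} [NonUnitalCStarAlgebra A]

variable {H : Type*} [NormedAddCommGroup H] [InnerProductSpace ℂ H] [CompleteSpace H]

theorem dense_actionSpan_rep (π : A →⋆ₙₐ[ℂ] (H →L[ℂ] H)) :
    Dense (actionSpan (π : A →ₗ[ℂ] (H →L[ℂ] H)) : Set H) := by
  rw [Submodule.dense_iff_topologicalClosure_eq_top, Submodule.topologicalClosure_eq_top_iff,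
    Submodule.eq_bot_iff]
  intro y hy
  rw [Submodule.mem_orthogonal] at hy
  have h1 : ∀ a, π a y = 0 := by
    intro a
    refine ext_inner_left ℂ fun v => ?_
    have := hy (π (star a) v) (Submodule.subset_span (Or.inl ⟨star a, v, rfl⟩))
    rw [map_star, ContinuousLinearMap.star_eq_adjoint,
      ContinuousLinearMap.adjoint_inner_left] at this
    simpa using this
  have := hy y (Submodule.subset_span (Or.inr h1))
  exact inner_self_eq_zero.mp this

theorem exists_repExt (π : A →⋆ₙₐ[ℂ] (H →L[ℂ] H)) (m : 𝓜(ℂ, A)) :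
    ∃ T : H →L[ℂ] H, (∀ a x, T (π a x) = π (m.fst a) x) ∧ ∀ y, (∀ a, π a y = 0) → T y = 0 :=
  exists_multiplier_action (π : A →ₗ[ℂ] (H →L[ℂ] H)) (fun a b x => by simp)
    (fun a => NonUnitalStarAlgHom.norm_apply_le π a) (dense_actionSpan_rep π) m

theorem rep_op_ext (π : A →⋆ₙₐ[ℂ] (H →L[ℂ] H)) {S T : H →L[ℂ] H}
    (h1 : ∀ a x, S (π a x) = T (π a x)) (h2 : ∀ y, (∀ a, π a y = 0) → S y = T y) : S = T := by
  refine ContinuousLinearMap.ext_on (dense_actionSpan_rep π) ?_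
  rintro y (⟨a, x, rfl⟩ | hy)
  · exact h1 a x
  · exact h2 y hy

theorem mult_mul_mul (m : 𝓜(ℂ, A)) (a b : A) : star a * m.fst b = star ((star m).fst a) * b := by
  have := mult_central' (star m) a b
  rw [star_star] at this
  exact this.symm

theorem rep_vec_ext (π : A →⋆ₙₐ[ℂ] (H →L[ℂ] H)) {u v : H}
    (h1 : ∀ a x, ⟪u, π a x⟫_ℂ = ⟪v, π a x⟫_ℂ)
    (h2 : ∀ y, (∀ a, π a y = 0) → ⟪u, y⟫_ℂ = ⟪v, y⟫_ℂ) : u = v := by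
  have : innerSL ℂ u = innerSL ℂ v := by
    refine ContinuousLinearMap.ext_on (dense_actionSpan_rep π) ?_
    rintro y (⟨a, x, rfl⟩ | hy)
    · exact h1 a x
    · exact h2 y hy
  exact ext_inner_right ℂ fun w => congrArg (fun φ : H →L[ℂ] ℂ => φ w) this

/-- The extension of a representation (possibly degenerate, then by zero) to the multiplier
algebra. -/
def repExt (π : A →⋆ₙₐ[ℂ] (H →L[ℂ] H)) : 𝓜(ℂ, A) →⋆ₙₐ[ℂ] (H →L[ℂ] H) :=
  let F : 𝓜(ℂ, A) → (H →L[ℂ] H) := fun m => (exists_repExt π m).choose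
  have h1 : ∀ m a x, F m (π a x) = π (m.fst a) x := fun m => (exists_repExt π m).choose_spec.1
  have h2 : ∀ m y, (∀ a, π a y = 0) → F m y = 0 := fun m => (exists_repExt π m).choose_spec.2
  { toFun := F
    map_smul' := fun c m => rep_op_ext π (fun a x => by simp [h1]) (fun y hy => by simp [h2, hy])
    map_zero' := rep_op_ext π (fun a x => by simp [h1]) (fun y hy => by simp [h2, hy])
    map_add' := fun m n =>
      rep_op_ext π (fun a x => by simp [h1]) (fun y hy => by simp [h2, hy])
    map_mul' := fun m n =>
      rep_op_ext π (fun a x => by simp [h1]) (fun y hy => by simp [h2, hy])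
    map_star' := fun m => by
      have hadj : ∀ (a : A) (x y : H), ⟪π a x, y⟫_ℂ = ⟪x, π (star a) y⟫_ℂ := fun a x y => by
        rw [map_star, ContinuousLinearMap.star_eq_adjoint, ContinuousLinearMap.adjoint_inner_right]
      refine rep_op_ext π (fun a x => ?_) (fun y hy => ?_)
      · rw [h1]
        refine rep_vec_ext π (fun b z => ?_) (fun z hz => ?_)
        · rw [ContinuousLinearMap.star_eq_adjoint, ContinuousLinearMap.adjoint_inner_left, h1,
            hadj, hadj, ← mul_apply_eq_comp, ← mul_apply_eq_comp,
            ← map_mul, ← map_mul, ← mult_mul_mul]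
        · rw [ContinuousLinearMap.star_eq_adjoint, ContinuousLinearMap.adjoint_inner_left, h2 m z hz,
            hadj, hz, inner_zero_right, inner_zero_right]
      · rw [h2 _ y hy]
        refine rep_vec_ext π (fun b z => ?_) (fun z hz => ?_)
        · have h0 : ⟪y, π (m.fst b) z⟫_ℂ = 0 := by
            rw [← star_star (m.fst b), ← hadj, hy, inner_zero_left]
          rw [ContinuousLinearMap.star_eq_adjoint, ContinuousLinearMap.adjoint_inner_left, h1,
            h0, inner_zero_left]
        · rw [ContinuousLinearMap.star_eq_adjoint, ContinuousLinearMap.adjoint_inner_left, h2 m z hz,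
            inner_zero_left, inner_zero_right] }

theorem repExt_apply (π : A →⋆ₙₐ[ℂ] (H →L[ℂ] H)) (m : 𝓜(ℂ, A)) (a : A) (x : H) :
    repExt π m (π a x) = π (m.fst a) x :=
  (exists_repExt π m).choose_spec.1 a x

end RepExt

section MultTensor

variable {A B : Type u} [NonUnitalCStarAlgebra A] [NonUnitalCStarAlgebra B]

/-- `(m ⊗ n) x` for multipliers `m`, `n` and `x` in the algebraic tensor product. -/
def algAct (m : 𝓜(ℂ, A)) (n : 𝓜(ℂ, B)) : A ⊗[ℂ] B →ₗ[ℂ] A ⊗[ℂ] B :=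
  TensorProduct.map (m.fst : A →ₗ[ℂ] A) (n.fst : B →ₗ[ℂ] B)

theorem prodRep_algAct (m : 𝓜(ℂ, A)) (n : 𝓜(ℂ, B)) (R : Rep A) (S : Rep B) (x : A ⊗[ℂ] B) :
    prodRep R.π S.π (algAct m n x) =
      opTensor (repExt R.π m) (repExt S.π n) * prodRep R.π S.π x := by
  induction x using TensorProduct.induction_on with
  | zero => simp only [map_zero, mul_zero]
  | tmul a b =>
    refine op_ext fun h k => ?_
    simp only [algAct, TensorProduct.map_tmul, prodRep_tmul, opTensor_tmul,
      mul_apply_eq_comp, repExt_apply, ContinuousLinearMap.coe_coe]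
  | add x y hx hy => rw [map_add, map_add, map_add, hx, hy, mul_add]

theorem norm_algAct_le (m : 𝓜(ℂ, A)) (n : 𝓜(ℂ, B)) (x : A ⊗[ℂ] B) :
    ‖ofAlg (algAct m n x)‖ ≤ ‖m‖ * ‖n‖ * ‖ofAlg x‖ := by
  refine norm_ofAlg_le (by positivity) fun R S => ?_
  rw [prodRep_algAct]
  refine (norm_mul_le _ _).trans ?_
  gcongr
  · refine (norm_opTensor_le _ _).trans ?_
    gcongr
    · exact NonUnitalStarAlgHom.norm_apply_le (repExt R.π) m
    · exact NonUnitalStarAlgHom.norm_apply_le (repExt S.π) n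
  · exact norm_prodRep_le R S x

/-- Left multiplication by `m ⊗ n` on the spatial tensor product. -/
def multL (m : 𝓜(ℂ, A)) (n : 𝓜(ℂ, B)) : A ⊗ₛ B →L[ℂ] A ⊗ₛ B :=
  (((ofAlg : (A ⊗[ℂ] B) →⋆ₙₐ[ℂ] A ⊗ₛ B) : (A ⊗[ℂ] B) →ₗ[ℂ] A ⊗ₛ B) ∘ₗ algAct m n).extendOfNorm
    ((ofAlg : (A ⊗[ℂ] B) →⋆ₙₐ[ℂ] A ⊗ₛ B) : (A ⊗[ℂ] B) →ₗ[ℂ] A ⊗ₛ B)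

theorem multL_ofAlg (m : 𝓜(ℂ, A)) (n : 𝓜(ℂ, B)) (x : A ⊗[ℂ] B) :
    multL m n (ofAlg x) = ofAlg (algAct m n x) :=
  LinearMap.extendOfNorm_eq
    (f := ((ofAlg : (A ⊗[ℂ] B) →⋆ₙₐ[ℂ] A ⊗ₛ B) : (A ⊗[ℂ] B) →ₗ[ℂ] A ⊗ₛ B) ∘ₗ algAct m n)
    (e := ((ofAlg : (A ⊗[ℂ] B) →⋆ₙₐ[ℂ] A ⊗ₛ B) : (A ⊗[ℂ] B) →ₗ[ℂ] A ⊗ₛ B))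
    denseRange_ofAlg ⟨‖m‖ * ‖n‖, norm_algAct_le m n⟩ x

theorem multL_tmul (m : 𝓜(ℂ, A)) (n : 𝓜(ℂ, B)) (a : A) (b : B) :
    multL m n (tmul a b) = tmul (m.fst a) (n.fst b) :=
  multL_ofAlg m n (a ⊗ₜ[ℂ] b)

theorem tmul_mul_tmul (a a' : A) (b b' : B) :
    tmul a b * tmul a' b' = tmul (a * a') (b * b') := by
  rw [tmul, tmul, ← map_mul, Algebra.TensorProduct.tmul_mul_tmul]; rfl

theorem star_tmul (a : A) (b : B) : star (tmul a b) = tmul (star a) (star b) := by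
  rw [tmul, ← map_star]; rfl

/-- Sesquilinear identities hold if they hold on elementary tensors. -/
theorem sesq_ext {L L' : A ⊗ₛ B →L[ℂ] A ⊗ₛ B}
    (h : ∀ a b a' b', star (L (tmul a b)) * tmul a' b' = star (tmul a b) * L' (tmul a' b'))
    (x y : A ⊗ₛ B) : star (L x) * y = star x * L' y := by
  refine denseRange_ofAlg.induction_on₂
    (p := fun x y => star (L x) * y = star x * L' y) ?_ ?_ x y
  · apply isClosed_eq <;> fun_prop
  · intro x y
    induction x using TensorProduct.induction_on with
    | zero => simp only [map_zero, star_zero, zero_mul]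
    | add x₁ x₂ h₁ h₂ => simp only [map_add, star_add, add_mul, h₁, h₂]
    | tmul a b =>
      induction y using TensorProduct.induction_on with
      | zero => simp only [map_zero, mul_zero]
      | add y₁ y₂ h₁ h₂ => simp only [map_add, mul_add, h₁, h₂]
      | tmul c d => exact h a b c d

/-- The multiplier `m ⊗ n` of `A ⊗ B`, for multipliers `m` of `A` and `n` of `B`. -/
def multTmul (m : 𝓜(ℂ, A)) (n : 𝓜(ℂ, B)) : 𝓜(ℂ, A ⊗ₛ B) :=
  mkMult (multL m n) (multL (star m) (star n)) <| sesq_ext fun a b a' b' => by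
    rw [multL_tmul, multL_tmul, star_tmul, star_tmul, tmul_mul_tmul, tmul_mul_tmul,
      mult_central', mult_central']

theorem multTmul_fst_tmul (m : 𝓜(ℂ, A)) (n : 𝓜(ℂ, B)) (a : A) (b : B) :
    (multTmul m n).fst (tmul a b) = tmul (m.fst a) (n.fst b) :=
  multL_tmul m n a b

/-- Multipliers of `A ⊗ B` that agree on elementary tensors agree. -/
theorem mult_tensor_ext {x y : 𝓜(ℂ, A ⊗ₛ B)}
    (h : ∀ a b, x.fst (tmul a b) = y.fst (tmul a b)) : x = y :=
  mult_ext fun z => congrArg (fun φ : A ⊗ₛ B →L[ℂ] A ⊗ₛ B => φ z) (tensor_ext h)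

/-- Multipliers with adjoint actions on elementary tensors are adjoint. -/
theorem star_multTmul (m : 𝓜(ℂ, A)) (n : 𝓜(ℂ, B)) :
    multTmul (star m) (star n) = star (multTmul m n) :=
  mult_ext fun a => by
    rw [DoubleCentralizer.star_fst]
    simp [multTmul, mkMult]

theorem tmul_add_left (a a' : A) (b : B) : tmul (a + a') b = tmul a b + tmul a' b := by
  simp only [tmul, TensorProduct.add_tmul, map_add]

theorem tmul_add_right (a : A) (b b' : B) : tmul a (b + b') = tmul a b + tmul a b' := by
  simp only [tmul, TensorProduct.tmul_add, map_add]

theorem tmul_smul_left (c : ℂ) (a : A) (b : B) : tmul (c • a) b = c • tmul a b := by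
  simp only [tmul, ← TensorProduct.smul_tmul', map_smul]

theorem tmul_smul_right (c : ℂ) (a : A) (b : B) : tmul a (c • b) = c • tmul a b := by
  simp only [tmul, TensorProduct.tmul_smul, map_smul]

/-- The map `M(A) ⊙ M(B) → M(A ⊗ B)`. -/
def multAlg : (𝓜(ℂ, A) ⊗[ℂ] 𝓜(ℂ, B)) →⋆ₙₐ[ℂ] 𝓜(ℂ, A ⊗ₛ B) :=
  algLift
    (LinearMap.mk₂ ℂ multTmul
      (fun m m' n => mult_tensor_ext fun a b => by
        simp [multTmul_fst_tmul, tmul_add_left])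
      (fun c m n => mult_tensor_ext fun a b => by
        simp [multTmul_fst_tmul, tmul_smul_left])
      (fun m n n' => mult_tensor_ext fun a b => by
        simp [multTmul_fst_tmul, tmul_add_right])
      (fun c m n => mult_tensor_ext fun a b => by
        simp [multTmul_fst_tmul, tmul_smul_right]))
    (fun m m' n n' => mult_tensor_ext fun a b => by simp [multTmul_fst_tmul])
    (fun m n => by simp only [LinearMap.mk₂_apply, star_multTmul])

theorem multAlg_tmul (m : 𝓜(ℂ, A)) (n : 𝓜(ℂ, B)) :
    multAlg (m ⊗ₜ[ℂ] n) = multTmul m n := rfl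

theorem exists_multAlg (z : 𝓜(ℂ, A) ⊗[ℂ] 𝓜(ℂ, B)) (x : A ⊗[ℂ] B) :
    ∃ y : A ⊗[ℂ] B, (multAlg z).fst (ofAlg x) = ofAlg y ∧ ∀ (R : Rep A) (S : Rep B),
      prodRep R.π S.π y = prodRep (repExt R.π) (repExt S.π) z * prodRep R.π S.π x := by
  induction z using TensorProduct.induction_on with
  | zero => exact ⟨0, by simp only [map_zero, DoubleCentralizer.zero_fst, zero_apply],
      fun R S => by simp only [map_zero, zero_mul]⟩
  | tmul m n =>
    exact ⟨algAct m n x, multL_ofAlg m n x, fun R S => prodRep_algAct m n R S x⟩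
  | add z w hz hw =>
    obtain ⟨y, h₁, h₂⟩ := hz
    obtain ⟨y', h₁', h₂'⟩ := hw
    refine ⟨y + y', ?_, fun R S => ?_⟩
    · rw [map_add, map_add, ← h₁, ← h₁', DoubleCentralizer.add_fst]; rfl
    · rw [map_add, map_add, h₂, h₂', add_mul]

theorem norm_multAlg_le (z : 𝓜(ℂ, A) ⊗[ℂ] 𝓜(ℂ, B)) : ‖multAlg z‖ ≤ ‖ofAlg z‖ := by
  rw [← DoubleCentralizer.norm_fst]
  refine ContinuousLinearMap.opNorm_le_bound _ (norm_nonneg _) fun x => ?_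
  refine denseRange_ofAlg.induction_on
    (p := fun x => ‖(multAlg z).fst x‖ ≤ ‖ofAlg z‖ * ‖x‖) x ?_ fun x => ?_
  · apply isClosed_le <;> fun_prop
  · obtain ⟨y, h₁, h₂⟩ := exists_multAlg z x
    rw [h₁]
    refine norm_ofAlg_le (by positivity) fun R S => ?_
    rw [h₂]
    refine (norm_mul_le _ _).trans ?_
    gcongr
    · exact norm_prodRep_le ⟨R.H, repExt R.π⟩ ⟨S.H, repExt S.π⟩ z
    · exact norm_prodRep_le R S x

/-- The canonical map `M(A) ⊗ M(B) → M(A ⊗ B)`. -/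
def multTensor : 𝓜(ℂ, A) ⊗ₛ 𝓜(ℂ, B) →⋆ₙₐ[ℂ] 𝓜(ℂ, A ⊗ₛ B) :=
  liftHom ofAlg denseRange_ofAlg multAlg norm_multAlg_le

theorem multTensor_tmul (m : 𝓜(ℂ, A)) (n : 𝓜(ℂ, B)) :
    multTensor (tmul m n) = multTmul m n :=
  liftHom_apply _ _ _ _ (m ⊗ₜ[ℂ] n)

end MultTensor

section Mor

/-- A morphism `A → B`: a non-degenerate `*`-homomorphism `f : A → M(B)`. Non-degeneracy means that
`f(A)B` has dense linear span in `B`; the same for `B f(A)` follows by taking adjoints. -/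
structure Mor (A B : Type u) [NonUnitalCStarAlgebra A] [NonUnitalCStarAlgebra B] where
  hom : A →⋆ₙₐ[ℂ] 𝓜(ℂ, B)
  nondegenerate :
    Dense (Submodule.span ℂ {y : B | ∃ (a : A) (b : B), (hom a).fst b = y} : Set B)

variable {A B C D : Type u} [NonUnitalCStarAlgebra A] [NonUnitalCStarAlgebra B]
  [NonUnitalCStarAlgebra C] [NonUnitalCStarAlgebra D]

/-- Left multiplication by a multiplier, as an algebra of operators. -/
def fstHom (f : A →⋆ₙₐ[ℂ] 𝓜(ℂ, B)) : A →ₗ[ℂ] (B →L[ℂ] B) where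
  toFun a := (f a).fst
  map_add' a b := by rw [map_add, DoubleCentralizer.add_fst]
  map_smul' c a := by rw [map_smul, DoubleCentralizer.smul_fst]; rfl

theorem Mor.dense_actionSpan (f : Mor A B) : Dense (actionSpan (fstHom f.hom) : Set B) :=
  f.nondegenerate.mono (Submodule.span_mono (by rintro _ ⟨a, b, h⟩; exact Or.inl ⟨a, b, h⟩))

theorem Mor.exists_ext (f : Mor A B) (m : 𝓜(ℂ, A)) :
    ∃ T : B →L[ℂ] B, ∀ a b, T ((f.hom a).fst b) = (f.hom (m.fst a)).fst b := by
  obtain ⟨T, hT, -⟩ := exists_multiplier_action (fstHom f.hom)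
    (fun a b x => by simp [fstHom])
    (fun a => by
      change ‖(f.hom a).fst‖ ≤ ‖a‖
      rw [DoubleCentralizer.norm_fst]
      exact NonUnitalStarAlgHom.norm_apply_le f.hom a) f.dense_actionSpan m
  exact ⟨T, hT⟩

theorem Mor.op_ext (f : Mor A B) {E : Type*} [NormedAddCommGroup E] [NormedSpace ℂ E]
    {S T : B →L[ℂ] E} (h : ∀ a b, S ((f.hom a).fst b) = T ((f.hom a).fst b)) : S = T := by
  refine ContinuousLinearMap.ext_on f.nondegenerate ?_
  rintro y ⟨a, b, rfl⟩
  exact h a b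

theorem Mor.mult_ext (f : Mor A B) {x y : 𝓜(ℂ, B)}
    (h : ∀ a b, x.fst ((f.hom a).fst b) = y.fst ((f.hom a).fst b)) : x = y :=
  QuantumCompactification.mult_ext fun z =>
    congrArg (fun φ : B →L[ℂ] B => φ z) (f.op_ext h)

theorem Mor.exists_mult (f : Mor A B) (m : 𝓜(ℂ, A)) :
    ∃ n : 𝓜(ℂ, B), ∀ a b, n.fst ((f.hom a).fst b) = (f.hom (m.fst a)).fst b := by
  obtain ⟨L, hL⟩ := f.exists_ext m
  obtain ⟨L', hL'⟩ := f.exists_ext (star m)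
  refine ⟨mkMult L L' fun x y => ?_, hL⟩
  have h1 : ∀ (a : A) (b : B) (y : B),
      star (L ((f.hom a).fst b)) * y = star ((f.hom a).fst b) * L' y := by
    intro a b y
    have : (ContinuousLinearMap.mul ℂ B (star (L ((f.hom a).fst b)))) =
        (ContinuousLinearMap.mul ℂ B (star ((f.hom a).fst b))).comp L' := by
      refine f.op_ext fun a' b' => ?_
      simp only [ContinuousLinearMap.mul_apply', ContinuousLinearMap.comp_apply, hL, hL']
      rw [mult_central', mult_central', ← map_star f.hom, ← map_star f.hom,
        ← mul_apply_eq_comp, ← mul_apply_eq_comp, ← DoubleCentralizer.mul_fst,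
        ← DoubleCentralizer.mul_fst, ← map_mul, ← map_mul, mult_central']
    exact congrArg (fun φ : B →L[ℂ] B => φ y) this
  have h2 : (ContinuousLinearMap.mul ℂ B (star y)).comp L =
      ContinuousLinearMap.mul ℂ B (star (L' y)) := by
    refine f.op_ext fun a b => ?_
    have := congrArg star (h1 a b y)
    simpa using this
  have := congrArg star (congrArg (fun φ : B →L[ℂ] B => φ x) h2)
  simpa using this

/-- The extension `M(A) → M(B)` of a non-degenerate `*`-homomorphism `f : A → M(B)`, determined by
`f(m) f(a) b = f(m a) b`. -/
def Mor.extend (f : Mor A B) : 𝓜(ℂ, A) →⋆ₙₐ[ℂ] 𝓜(ℂ, B) :=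
  let F : 𝓜(ℂ, A) → 𝓜(ℂ, B) := fun m => (f.exists_mult m).choose
  have hF : ∀ m a b, (F m).fst ((f.hom a).fst b) = (f.hom (m.fst a)).fst b :=
    fun m => (f.exists_mult m).choose_spec
  { toFun := F
    map_smul' := fun c m => f.mult_ext fun a b => by simp [hF]
    map_zero' := f.mult_ext fun a b => by simp [hF]
    map_add' := fun m n => f.mult_ext fun a b => by simp [hF]
    map_mul' := fun m n => f.mult_ext fun a b => by simp [hF]
    map_star' := fun m => f.mult_ext fun a b => by
      rw [hF]
      have key : ∀ y, star ((f.hom ((star m).fst a)).fst b) * y =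
          star ((star (F m)).fst ((f.hom a).fst b)) * y := by
        intro y
        have : (ContinuousLinearMap.mul ℂ B (star ((f.hom ((star m).fst a)).fst b))) =
            ContinuousLinearMap.mul ℂ B (star ((star (F m)).fst ((f.hom a).fst b))) := by
          refine f.op_ext fun a' b' => ?_
          simp only [ContinuousLinearMap.mul_apply']
          rw [← mult_mul_mul, hF, mult_central', mult_central', ← map_star f.hom, ← map_star f.hom,
            ← mul_apply_eq_comp, ← mul_apply_eq_comp, ← DoubleCentralizer.mul_fst,
            ← DoubleCentralizer.mul_fst, ← map_mul, ← map_mul, ← mult_mul_mul]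
        exact congrArg (fun φ : B →L[ℂ] B => φ y) this
      have h0 := key (star (star ((f.hom ((star m).fst a)).fst b) -
        star ((star (F m)).fst ((f.hom a).fst b))))
      rw [← sub_eq_zero, ← sub_mul, CStarRing.mul_star_self_eq_zero_iff, sub_eq_zero] at h0
      exact star_injective h0 }

theorem Mor.extend_apply (f : Mor A B) (m : 𝓜(ℂ, A)) (a : A) (b : B) :
    (f.extend m).fst ((f.hom a).fst b) = (f.hom (m.fst a)).fst b :=
  (f.exists_mult m).choose_spec a b

theorem Mor.extend_coe (f : Mor A B) (a : A) : f.extend (a : 𝓜(ℂ, A)) = f.hom a :=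
  f.mult_ext fun c b => by
    rw [f.extend_apply, DoubleCentralizer.coe_fst, ContinuousLinearMap.mul_apply', map_mul,
      DoubleCentralizer.mul_fst, mul_apply_eq_comp]

theorem mem_closure_range_mul (b : B) :
    b ∈ closure (Set.range fun e : B => e * b) := by
  let _ := CStarAlgebra.spectralOrder B
  have _ := CStarAlgebra.spectralOrderedRing B
  exact mem_closure_of_tendsto ((CStarAlgebra.increasingApproximateUnit B).tendsto_mul_right b)
    (Filter.Eventually.of_forall fun e => ⟨e, rfl⟩)

/-- A non-degenerate `*`-homomorphism with values in `B` itself. -/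
def Mor.ofHom (f : A →⋆ₙₐ[ℂ] B)
    (hf : Dense (Submodule.span ℂ {y : B | ∃ (a : A) (b : B), f a * b = y} : Set B)) :
    Mor A B where
  hom := DoubleCentralizer.coeHom.comp f
  nondegenerate := hf

/-- The identity morphism. -/
def Mor.id (A : Type u) [NonUnitalCStarAlgebra A] : Mor A A :=
  Mor.ofHom (NonUnitalStarAlgHom.id ℂ A) fun b =>
    closure_mono (by rintro _ ⟨e, rfl⟩; exact Submodule.subset_span ⟨e, b, rfl⟩)
      (mem_closure_range_mul b)

/-- Composition of morphisms. -/
def Mor.comp (g : Mor B C) (f : Mor A B) : Mor A C where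
  hom := g.extend.comp f.hom
  nondegenerate := by
    set W := Submodule.span ℂ {y : C | ∃ (a : A) (b : C), ((g.extend.comp f.hom) a).fst b = y}
    have h1 : ∀ (b : B) (c : C), (g.hom b).fst c ∈ W.topologicalClosure := by
      intro b c
      have hc : Continuous fun b : B => (fstHom g.hom b) c :=
        (AddMonoidHomClass.continuous_of_bound (fstHom g.hom) 1 fun b => by
          rw [one_mul]
          change ‖(g.hom b).fst‖ ≤ _
          rw [DoubleCentralizer.norm_fst]
          exact NonUnitalStarAlgHom.norm_apply_le g.hom b).clm_apply continuous_const
      have hcl : IsClosed {b : B | (fstHom g.hom b) c ∈ W.topologicalClosure} :=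
        W.isClosed_topologicalClosure.preimage hc
      refine closure_minimal (fun b hb => ?_) hcl (f.nondegenerate b)
      induction hb using Submodule.span_induction with
      | mem x hx =>
        obtain ⟨a, b, rfl⟩ := hx
        refine W.le_topologicalClosure (Submodule.subset_span ⟨a, (g.hom b).fst c, ?_⟩)
        exact g.extend_apply (f.hom a) b c
      | zero => simp
      | add x y _ _ hx hy =>
        simp only [Set.mem_ofPred_eq, map_add, add_apply] at hx hy ⊢
        exact add_mem hx hy
      | smul r x _ hx =>
        simp only [Set.mem_ofPred_eq, map_smul, smul_apply] at hx ⊢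
        exact W.topologicalClosure.smul_mem r hx
    have h2 : Submodule.span ℂ {y : C | ∃ (b : B) (c : C), (g.hom b).fst c = y} ≤
        W.topologicalClosure := by
      refine Submodule.span_le.mpr ?_
      rintro _ ⟨b, c, rfl⟩
      exact h1 b c
    intro c
    exact closure_minimal (t := (W.topologicalClosure : Set C)) h2
      W.isClosed_topologicalClosure (g.nondegenerate c)

/-- `f ⊗ g : A ⊗ B → M(C) ⊗ M(D) → M(C ⊗ D)`. -/
def homTensor (f : A →⋆ₙₐ[ℂ] 𝓜(ℂ, C)) (g : B →⋆ₙₐ[ℂ] 𝓜(ℂ, D)) : A ⊗ₛ B →⋆ₙₐ[ℂ] 𝓜(ℂ, C ⊗ₛ D) :=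
  multTensor.comp (tensorMap f g)

theorem homTensor_tmul (f : A →⋆ₙₐ[ℂ] 𝓜(ℂ, C)) (g : B →⋆ₙₐ[ℂ] 𝓜(ℂ, D)) (a : A) (b : B) :
    homTensor f g (tmul a b) = multTmul (f a) (g b) := by
  change multTensor (tensorMap f g (tmul a b)) = _
  rw [tensorMap_tmul, multTensor_tmul]

theorem homTensor_tmul_fst (f : A →⋆ₙₐ[ℂ] 𝓜(ℂ, C)) (g : B →⋆ₙₐ[ℂ] 𝓜(ℂ, D)) (a : A) (b : B)
    (c : C) (d : D) :
    (homTensor f g (tmul a b)).fst (tmul c d) = tmul ((f a).fst c) ((g b).fst d) := by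
  rw [homTensor_tmul, multTmul_fst_tmul]

theorem continuous_tmul_left (b : B) : Continuous fun a : A => tmul a b :=
  (AddMonoidHomClass.continuous_of_bound
    (((ofAlg : (A ⊗[ℂ] B) →⋆ₙₐ[ℂ] A ⊗ₛ B) : (A ⊗[ℂ] B) →ₗ[ℂ] A ⊗ₛ B) ∘ₗ
      (TensorProduct.mk ℂ A B).flip b) ‖b‖ fun a => by
    refine norm_ofAlg_le (by positivity) fun R S => ?_
    refine (norm_opTensor_le _ _).trans ?_
    rw [mul_comm]
    gcongr
    · exact NonUnitalStarAlgHom.norm_apply_le S.π b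
    · exact NonUnitalStarAlgHom.norm_apply_le R.π a)

theorem continuous_tmul_right (a : A) : Continuous fun b : B => tmul a b :=
  (AddMonoidHomClass.continuous_of_bound
    (((ofAlg : (A ⊗[ℂ] B) →⋆ₙₐ[ℂ] A ⊗ₛ B) : (A ⊗[ℂ] B) →ₗ[ℂ] A ⊗ₛ B) ∘ₗ
      (TensorProduct.mk ℂ A B) a) ‖a‖ fun b => by
    refine norm_ofAlg_le (by positivity) fun R S => ?_
    refine (norm_opTensor_le _ _).trans ?_
    gcongr
    · exact NonUnitalStarAlgHom.norm_apply_le R.π a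
    · exact NonUnitalStarAlgHom.norm_apply_le S.π b)

theorem tmul_zero_left (b : B) : tmul (0 : A) b = 0 := by
  simp only [tmul, TensorProduct.zero_tmul, map_zero]

theorem tmul_zero_right (a : A) : tmul a (0 : B) = 0 := by
  simp only [tmul, TensorProduct.tmul_zero, map_zero]

/-- A closed subspace that contains `a ⊗ b` for `a`, `b` in dense spans is everything. -/
theorem dense_of_tmul_mem {s : Set A} {t : Set B} (hs : Dense (Submodule.span ℂ s : Set A))
    (ht : Dense (Submodule.span ℂ t : Set B)) (W : Submodule ℂ (A ⊗ₛ B))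
    (h : ∀ a ∈ s, ∀ b ∈ t, tmul a b ∈ W) : Dense (W : Set (A ⊗ₛ B)) := by
  have h1 : ∀ a ∈ s, ∀ b : B, tmul a b ∈ W.topologicalClosure := by
    intro a ha b
    refine closure_minimal (t := {b : B | tmul a b ∈ W.topologicalClosure}) (fun b hb => ?_)
      (W.isClosed_topologicalClosure.preimage (continuous_tmul_right a)) (ht b)
    induction hb using Submodule.span_induction with
    | mem x hx => exact W.le_topologicalClosure (h a ha x hx)
    | zero => simp only [Set.mem_ofPred_eq, tmul_zero_right]; exact zero_mem _
    | add x y _ _ hx hy =>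
      simp only [Set.mem_ofPred_eq, tmul_add_right] at hx hy ⊢; exact add_mem hx hy
    | smul r x _ hx =>
      simp only [Set.mem_ofPred_eq, tmul_smul_right] at hx ⊢
      exact W.topologicalClosure.smul_mem r hx
  have h2 : ∀ (a : A) (b : B), tmul a b ∈ W.topologicalClosure := by
    intro a b
    refine closure_minimal (t := {a : A | tmul a b ∈ W.topologicalClosure}) (fun a ha => ?_)
      (W.isClosed_topologicalClosure.preimage (continuous_tmul_left b)) (hs a)
    induction ha using Submodule.span_induction with
    | mem x hx => exact h1 x hx b
    | zero => simp only [Set.mem_ofPred_eq, tmul_zero_left]; exact zero_mem _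
    | add x y _ _ hx hy =>
      simp only [Set.mem_ofPred_eq, tmul_add_left] at hx hy ⊢; exact add_mem hx hy
    | smul r x _ hx =>
      simp only [Set.mem_ofPred_eq, tmul_smul_left] at hx ⊢
      exact W.topologicalClosure.smul_mem r hx
  intro z
  refine closure_minimal (t := (W.topologicalClosure : Set (A ⊗ₛ B))) ?_
    W.isClosed_topologicalClosure (denseRange_ofAlg z)
  rintro _ ⟨x, rfl⟩
  induction x using TensorProduct.induction_on with
  | zero => rw [map_zero]; exact zero_mem _
  | tmul a b => exact h2 a b
  | add x y hx hy => rw [map_add]; exact add_mem hx hy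

/-- The tensor product of morphisms. -/
def Mor.tensor (f : Mor A C) (g : Mor B D) : Mor (A ⊗ₛ B) (C ⊗ₛ D) where
  hom := homTensor f.hom g.hom
  nondegenerate := by
    refine dense_of_tmul_mem f.nondegenerate g.nondegenerate _ ?_
    rintro _ ⟨a, c, rfl⟩ _ ⟨b, d, rfl⟩
    exact Submodule.subset_span ⟨tmul a b, tmul c d, homTensor_tmul_fst _ _ _ _ _ _⟩

end Mor

section Matrix

variable {B : Type*} [NonUnitalCStarAlgebra B]
  {K : Type*} [NormedAddCommGroup K] [InnerProductSpace ℂ K] [CompleteSpace K] {n : ℕ}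

/-- The amplification of a representation to matrices. -/
def matRep (σ : B →⋆ₙₐ[ℂ] (K →L[ℂ] K)) (n : ℕ) : CStarMatrix (Fin n) (Fin n) B →⋆ₙₐ[ℂ]
    (PiLp 2 (fun _ : Fin n => K) →L[ℂ] PiLp 2 (fun _ : Fin n => K)) where
  toFun X := (PiLp.continuousLinearEquiv 2 ℂ (fun _ : Fin n => K)).symm.toContinuousLinearMap.comp
    (ContinuousLinearMap.pi fun i => ∑ j, (σ (X i j)).comp (PiLp.proj 2 (fun _ : Fin n => K) j))
  map_smul' c X := by ext k i; simp [Finset.smul_sum]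
  map_zero' := by ext k i; simp
  map_add' X Y := by ext k i; simp [Finset.sum_add_distrib]
  map_mul' X Y := by
    ext k i
    simp only [CStarMatrix.mul_apply, map_sum, map_mul]
    simp only [ContinuousLinearMap.comp_apply, ContinuousLinearEquiv.coe_coe,
      PiLp.continuousLinearEquiv_symm_apply, ContinuousLinearMap.coe_pi', sum_apply,
      PiLp.proj_apply, mul_apply_eq_comp, map_sum]
    rw [Finset.sum_comm]
  map_star' X := by
    refine (ContinuousLinearMap.eq_adjoint_iff _ _).mpr fun x y => ?_
    simp only [PiLp.inner_apply]
    simp [CStarMatrix.star_apply, map_star, sum_inner, inner_sum,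
      ContinuousLinearMap.star_eq_adjoint, ContinuousLinearMap.adjoint_inner_left]
    rw [Finset.sum_comm]

theorem matRep_apply (σ : B →⋆ₙₐ[ℂ] (K →L[ℂ] K)) (X : CStarMatrix (Fin n) (Fin n) B)
    (k : PiLp 2 (fun _ : Fin n => K)) (i : Fin n) :
    matRep σ n X k i = ∑ j, σ (X i j) (k j) := by
  simp [matRep]

/-- The norm of a C*-algebra is computed by any jointly faithful family of `*`-homomorphisms. -/
theorem norm_le_of_family {X ι : Type*} {E : ι → Type*} [NonUnitalCStarAlgebra X]
    [∀ i, NonUnitalCStarAlgebra (E i)] (f : ∀ i, X →⋆ₙₐ[ℂ] E i)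
    (hf : ∀ x, (∀ i, f i x = 0) → x = 0) (x : X) {M : ℝ} (hM : 0 ≤ M) (h : ∀ i, ‖f i x‖ ≤ M) :
    ‖x‖ ≤ M := by
  let Φ : X →⋆ₙₐ[ℂ] lp E ∞ :=
    { toFun := fun x => ⟨fun i => f i x, memℓp_infty ⟨‖x‖, by
        rintro _ ⟨i, rfl⟩; exact NonUnitalStarAlgHom.norm_apply_le (f i) x⟩⟩
      map_smul' := fun c x => Subtype.ext <| funext fun i => map_smul (f i) c x
      map_zero' := Subtype.ext <| funext fun i => map_zero (f i)
      map_add' := fun x y => Subtype.ext <| funext fun i => map_add (f i) x y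
      map_mul' := fun x y => Subtype.ext <| funext fun i => map_mul (f i) x y
      map_star' := fun x => Subtype.ext <| funext fun i => map_star (f i) x }
  have hinj : Function.Injective Φ := by
    refine (injective_iff_map_eq_zero Φ).mpr fun x hx => hf x fun i => ?_
    exact congrFun (congrArg Subtype.val hx) i
  rw [← NonUnitalStarAlgHom.norm_map Φ hinj x]
  exact lp.norm_le_of_forall_le hM h

/-- Matrix norms are computed by any jointly faithful family of representations. -/
theorem norm_matRep_le {B : Type u} [NonUnitalCStarAlgebra B] (S : Rep B) {ι : Type u}
    (T : ι → Rep B) (hT : ∀ b, (∀ i, (T i).π b = 0) → b = 0)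
    (X : CStarMatrix (Fin n) (Fin n) B) {M : ℝ} (hM : 0 ≤ M)
    (h : ∀ i, ‖matRep (T i).π n X‖ ≤ M) : ‖matRep S.π n X‖ ≤ M := by
  let _ := CStarAlgebra.spectralOrder B
  have _ := CStarAlgebra.spectralOrderedRing B
  refine (NonUnitalStarAlgHom.norm_apply_le (matRep S.π n) X).trans ?_
  refine norm_le_of_family (fun i => matRep (T i).π n) (fun X hX => ?_) X hM h
  refine CStarMatrix.ext fun a b => hT _ fun i => ?_
  ext k
  have := congrArg (fun φ : PiLp 2 (fun _ : Fin n => (T i).H) →L[ℂ]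
    PiLp 2 (fun _ : Fin n => (T i).H) => φ (PiLp.single 2 b k) a) (hX i)
  simp only [matRep_apply] at this
  rw [Finset.sum_eq_single b] at this
  · simpa using this
  · intro j _ hj; simp [hj]
  · simp

end Matrix

section Independence

variable {A B : Type u} [NonUnitalCStarAlgebra A] [NonUnitalCStarAlgebra B]
  {H : Type*} [NormedAddCommGroup H] [InnerProductSpace ℂ H] [CompleteSpace H]
  {K : Type*} [NormedAddCommGroup K] [InnerProductSpace ℂ K] [CompleteSpace K] {n : ℕ}

/-- The matrix of `x` with entries in `B`, compressed along vectors `h₁, …, hₙ`. -/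
def compress (π : A →⋆ₙₐ[ℂ] (H →L[ℂ] H)) (h : Fin n → H) (x : A ⊗[ℂ] B) :
    CStarMatrix (Fin n) (Fin n) B :=
  CStarMatrix.ofMatrix fun i j => TensorProduct.lid ℂ B
    (TensorProduct.map (((innerSL ℂ (h i) : H →L[ℂ] ℂ) : H →ₗ[ℂ] ℂ) ∘ₗ
      ((ContinuousLinearMap.apply ℂ H (h j) : (H →L[ℂ] H) →L[ℂ] H) : (H →L[ℂ] H) →ₗ[ℂ] H) ∘ₗ
      (π : A →ₗ[ℂ] (H →L[ℂ] H))) LinearMap.id x)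

theorem compress_tmul (π : A →⋆ₙₐ[ℂ] (H →L[ℂ] H)) (h : Fin n → H) (a : A) (b : B) (i j : Fin n) :
    compress π h (a ⊗ₜ[ℂ] b) i j = ⟪h i, π a (h j)⟫_ℂ • b := rfl

theorem compress_add (π : A →⋆ₙₐ[ℂ] (H →L[ℂ] H)) (h : Fin n → H) (x y : A ⊗[ℂ] B) :
    compress π h (x + y) = compress π h x + compress π h y := by
  refine CStarMatrix.ext fun i j => ?_
  simp only [compress, CStarMatrix.add_apply, map_add]
  rfl

theorem compress_zero (π : A →⋆ₙₐ[ℂ] (H →L[ℂ] H)) (h : Fin n → H) :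
    compress π h (0 : A ⊗[ℂ] B) = 0 := by
  refine CStarMatrix.ext fun i j => ?_
  simp only [compress, CStarMatrix.zero_apply, map_zero]
  rfl

theorem inner_prodRep (π : A →⋆ₙₐ[ℂ] (H →L[ℂ] H)) (σ : B →⋆ₙₐ[ℂ] (K →L[ℂ] K)) (h : Fin n → H)
    (k l : PiLp 2 (fun _ : Fin n => K)) (x : A ⊗[ℂ] B) :
    ⟪hilbertEmb (∑ i, h i ⊗ₜ[ℂ] l i), prodRep π σ x (hilbertEmb (∑ j, h j ⊗ₜ[ℂ] k j))⟫_ℂ =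
      ⟪l, matRep σ n (compress π h x) k⟫_ℂ := by
  induction x using TensorProduct.induction_on with
  | zero => simp [compress_zero]
  | add x y hx hy => rw [compress_add, map_add, map_add, add_apply, add_apply, inner_add_right,
      inner_add_right, hx, hy]
  | tmul a b =>
    simp only [prodRep_tmul, opTensor_emb, LinearIsometry.inner_map_map, PiLp.inner_apply,
      matRep_apply, compress_tmul, map_sum, TensorProduct.mapL_tmul, sum_inner, inner_sum,
      TensorProduct.inner_tmul, map_smul, smul_apply, inner_smul_right]
    rw [Finset.sum_comm]

theorem norm_emb_sum (h : Fin n → H) (hh : Orthonormal ℂ h) (k : PiLp 2 (fun _ : Fin n => K)) :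
    ‖(hilbertEmb (∑ i, h i ⊗ₜ[ℂ] k i) : HilbertTensor H K)‖ = ‖k‖ := by
  rw [LinearIsometry.norm_map]
  set v : H ⊗[ℂ] K := ∑ i, h i ⊗ₜ[ℂ] k i with hv
  have : ⟪v, v⟫_ℂ = ⟪k, k⟫_ℂ := by
    rw [hv]
    simp only [sum_inner, inner_sum, TensorProduct.inner_tmul, PiLp.inner_apply]
    refine Finset.sum_congr rfl fun i _ => ?_
    rw [Finset.sum_eq_single i]
    · simp [hh.1 i]
    · intro j _ hj; rw [hh.2 hj, zero_mul]
    · simp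
  have e1 : ⟪v, v⟫_ℂ = (‖v‖ : ℂ) ^ 2 := inner_self_eq_norm_sq_to_K v
  rw [e1, inner_self_eq_norm_sq_to_K] at this
  have h2 : ‖v‖ ^ 2 = ‖k‖ ^ 2 := by
    have t : ((‖v‖ ^ 2 : ℝ) : ℂ) = ((‖k‖ ^ 2 : ℝ) : ℂ) := by simpa using this
    exact Complex.ofReal_injective t
  exact (sq_eq_sq₀ (norm_nonneg _) (norm_nonneg _)).mp h2

theorem exists_orthonormal_expansion (x y : H ⊗[ℂ] K) :
    ∃ (n : ℕ) (h : Fin n → H) (k l : PiLp 2 (fun _ : Fin n => K)), Orthonormal ℂ h ∧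
      x = ∑ i, h i ⊗ₜ[ℂ] k i ∧ y = ∑ i, h i ⊗ₜ[ℂ] l i := by
  obtain ⟨E, F, hE, hF, hs⟩ := TensorProduct.exists_finite_submodule_of_setFinite {x, y}
    (Set.toFinite _)
  obtain ⟨x', rfl⟩ := hs (Set.mem_insert x {y})
  obtain ⟨y', rfl⟩ := hs (Set.mem_insert_of_mem _ rfl)
  let e := stdOrthonormalBasis ℂ E
  obtain ⟨c, rfl⟩ := TensorProduct.eq_repr_basis_left e.toBasis x'
  obtain ⟨d, rfl⟩ := TensorProduct.eq_repr_basis_left e.toBasis y'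
  refine ⟨Module.finrank ℂ E, fun i => (e i : H), WithLp.toLp 2 fun i => (c i : K),
    WithLp.toLp 2 fun i => (d i : K), e.orthonormal.comp_linearIsometry E.subtypeₗᵢ, ?_, ?_⟩
  · rw [Finsupp.sum_fintype _ _ (by simp)]; simp [TensorProduct.mapIncl]
  · rw [Finsupp.sum_fintype _ _ (by simp)]; simp [TensorProduct.mapIncl]

theorem norm_le_of_forall_inner {E : Type*} [NormedAddCommGroup E] [InnerProductSpace ℂ E]
    {v : E} {C : ℝ} (hC : 0 ≤ C) (h : ∀ w, ‖⟪w, v⟫_ℂ‖ ≤ C * ‖w‖) : ‖v‖ ≤ C := by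
  have := h v
  rw [inner_self_eq_norm_sq_to_K, norm_pow, RCLike.norm_ofReal, abs_norm] at this
  by_contra hlt
  push Not at hlt
  have : 0 < ‖v‖ := hC.trans_lt hlt
  nlinarith

/-- The spatial norm can be computed with any jointly faithful family of representations. -/
theorem norm_prodRep_le_of_family (R : Rep A) (S : Rep B) {ι : Type u} (T : ι → Rep B)
    (hT : ∀ b, (∀ i, (T i).π b = 0) → b = 0) (x : A ⊗[ℂ] B) {M : ℝ} (hM : 0 ≤ M)
    (h : ∀ i, ‖prodRep R.π (T i).π x‖ ≤ M) : ‖prodRep R.π S.π x‖ ≤ M := by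
  have key : ∀ ξ η : R.H ⊗[ℂ] S.H,
      ‖⟪hilbertEmb η, prodRep R.π S.π x (hilbertEmb ξ)⟫_ℂ‖ ≤ M * ‖ξ‖ * ‖η‖ := by
    intro ξ η
    obtain ⟨n, e, k, l, he, rfl, rfl⟩ := exists_orthonormal_expansion ξ η
    rw [inner_prodRep]
    have hX : ‖matRep S.π n (compress R.π e x)‖ ≤ M := by
      refine norm_matRep_le S T hT _ hM fun i => ?_
      refine ContinuousLinearMap.opNorm_le_bound _ hM fun k => ?_
      refine norm_le_of_forall_inner (by positivity) fun l => ?_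
      rw [← inner_prodRep, ← norm_emb_sum (K := (T i).H) e he k,
        ← norm_emb_sum (K := (T i).H) e he l, mul_comm]
      refine (norm_inner_le_norm _ _).trans ?_
      gcongr
      exact ContinuousLinearMap.le_of_opNorm_le _ (h i) _
    have h1 := norm_emb_sum (K := S.H) e he k
    have h2 := norm_emb_sum (K := S.H) e he l
    rw [LinearIsometry.norm_map] at h1 h2
    rw [h1, h2]
    calc _ ≤ ‖l‖ * ‖matRep S.π n (compress R.π e x) k‖ := norm_inner_le_norm _ _
      _ ≤ ‖l‖ * (M * ‖k‖) := by
        gcongr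
        exact ContinuousLinearMap.le_of_opNorm_le _ hX k
      _ = _ := by ring
  refine ContinuousLinearMap.opNorm_le_bound _ hM fun ξ => ?_
  refine denseRange_hilbertEmb.induction_on
    (p := fun ξ => ‖prodRep R.π S.π x ξ‖ ≤ M * ‖ξ‖) ξ ?_ fun ξ => ?_
  · apply isClosed_le <;> fun_prop
  · refine norm_le_of_forall_inner (by positivity) fun η => ?_
    refine denseRange_hilbertEmb.induction_on
      (p := fun η => ‖⟪η, prodRep R.π S.π x (hilbertEmb ξ)⟫_ℂ‖ ≤ M * ‖hilbertEmb ξ‖ * ‖η‖)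
      η ?_ fun η => ?_
    · apply isClosed_le <;> fun_prop
    · rw [LinearIsometry.norm_map, LinearIsometry.norm_map]
      exact key ξ η

end Independence

section HilbertAssoc

variable {H K L : Type*} [NormedAddCommGroup H] [InnerProductSpace ℂ H]
  [NormedAddCommGroup K] [InnerProductSpace ℂ K] [NormedAddCommGroup L] [InnerProductSpace ℂ L]

def assocEmbLeft (H K L : Type*) [NormedAddCommGroup H] [InnerProductSpace ℂ H]
    [NormedAddCommGroup K] [InnerProductSpace ℂ K] [NormedAddCommGroup L] [InnerProductSpace ℂ L] :
    ((H ⊗[ℂ] K) ⊗[ℂ] L) →ₗᵢ[ℂ] HilbertTensor (HilbertTensor H K) L :=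
  hilbertEmb.comp (TensorProduct.mapIsometry hilbertEmb LinearIsometry.id)

def assocEmbRight (H K L : Type*) [NormedAddCommGroup H] [InnerProductSpace ℂ H]
    [NormedAddCommGroup K] [InnerProductSpace ℂ K] [NormedAddCommGroup L] [InnerProductSpace ℂ L] :
    (H ⊗[ℂ] (K ⊗[ℂ] L)) →ₗᵢ[ℂ] HilbertTensor H (HilbertTensor K L) :=
  hilbertEmb.comp (TensorProduct.mapIsometry LinearIsometry.id hilbertEmb)

theorem assocEmbLeft_tmul (x : H ⊗[ℂ] K) (l : L) :
    assocEmbLeft H K L (x ⊗ₜ[ℂ] l) = hilbertEmb (hilbertEmb x ⊗ₜ[ℂ] l) := rfl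

theorem assocEmbRight_tmul (h : H) (x : K ⊗[ℂ] L) :
    assocEmbRight H K L (h ⊗ₜ[ℂ] x) = hilbertEmb (h ⊗ₜ[ℂ] hilbertEmb x) := rfl

theorem denseRange_of_tmul_mem {W : Submodule ℂ (HilbertTensor H K)}
    (hW : ∀ h k, hilbertEmb (h ⊗ₜ[ℂ] k) ∈ W.topologicalClosure) :
    Dense (W : Set (HilbertTensor H K)) := by
  intro z
  refine closure_minimal (t := (W.topologicalClosure : Set _)) ?_
    W.isClosed_topologicalClosure (denseRange_hilbertEmb z)
  rintro _ ⟨x, rfl⟩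
  induction x using TensorProduct.induction_on with
  | zero => rw [map_zero]; exact zero_mem _
  | tmul a b => exact hW a b
  | add x y hx hy => rw [map_add]; exact add_mem hx hy

theorem denseRange_assocEmbLeft : DenseRange (assocEmbLeft H K L) := by
  refine denseRange_of_tmul_mem (W := LinearMap.range (assocEmbLeft H K L).toLinearMap) ?_
  intro z l
  refine closure_minimal (s := Set.range (hilbertEmb : (H ⊗[ℂ] K) →ₗᵢ[ℂ] HilbertTensor H K))
    (t := {z | hilbertEmb (z ⊗ₜ[ℂ] l) ∈
      (LinearMap.range (assocEmbLeft H K L).toLinearMap).topologicalClosure}) ?_ ?_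
    (denseRange_hilbertEmb z)
  · rintro _ ⟨x, rfl⟩
    exact Submodule.le_topologicalClosure _ ⟨x ⊗ₜ[ℂ] l, rfl⟩
  · refine (Submodule.isClosed_topologicalClosure _).preimage ?_
    exact hilbertEmb.continuous.comp
      (TensorProduct.continuous_tmul.comp (continuous_id.prodMk continuous_const))

theorem denseRange_assocEmbRight : DenseRange (assocEmbRight H K L) := by
  refine denseRange_of_tmul_mem (W := LinearMap.range (assocEmbRight H K L).toLinearMap) ?_
  intro h z
  refine closure_minimal (s := Set.range (hilbertEmb : (K ⊗[ℂ] L) →ₗᵢ[ℂ] HilbertTensor K L))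
    (t := {z | hilbertEmb (h ⊗ₜ[ℂ] z) ∈
      (LinearMap.range (assocEmbRight H K L).toLinearMap).topologicalClosure}) ?_ ?_
    (denseRange_hilbertEmb z)
  · rintro _ ⟨x, rfl⟩
    exact Submodule.le_topologicalClosure _ ⟨h ⊗ₜ[ℂ] x, rfl⟩
  · refine (Submodule.isClosed_topologicalClosure _).preimage ?_
    exact hilbertEmb.continuous.comp
      (TensorProduct.continuous_tmul.comp (continuous_const.prodMk continuous_id))

/-- The associativity isomorphism of Hilbert space tensor products. -/
def hilbertAssoc (H K L : Type*) [NormedAddCommGroup H] [InnerProductSpace ℂ H]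
    [NormedAddCommGroup K] [InnerProductSpace ℂ K] [NormedAddCommGroup L] [InnerProductSpace ℂ L] :
    HilbertTensor (HilbertTensor H K) L ≃ₗᵢ[ℂ] HilbertTensor H (HilbertTensor K L) :=
  (TensorProduct.assoc ℂ H K L).extendOfIsometry (assocEmbLeft H K L).toLinearMap
    (assocEmbRight H K L).toLinearMap denseRange_assocEmbLeft denseRange_assocEmbRight fun x => by
      change ‖assocEmbRight H K L (TensorProduct.assoc ℂ H K L x)‖ = ‖assocEmbLeft H K L x‖
      rw [LinearIsometry.norm_map, LinearIsometry.norm_map, TensorProduct.norm_assoc]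

theorem hilbertAssoc_emb (x : (H ⊗[ℂ] K) ⊗[ℂ] L) :
    hilbertAssoc H K L (assocEmbLeft H K L x) =
      assocEmbRight H K L (TensorProduct.assoc ℂ H K L x) :=
  LinearEquiv.extendOfIsometry_eq _ _ _ _ _ _ x

theorem hilbertAssoc_tmul (h : H) (k : K) (l : L) :
    hilbertAssoc H K L (hilbertEmb (hilbertEmb (h ⊗ₜ[ℂ] k) ⊗ₜ[ℂ] l)) =
      hilbertEmb (h ⊗ₜ[ℂ] hilbertEmb (k ⊗ₜ[ℂ] l)) :=
  hilbertAssoc_emb ((h ⊗ₜ[ℂ] k) ⊗ₜ[ℂ] l)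

end HilbertAssoc

section Assoc

variable {A B D : Type u} [NonUnitalCStarAlgebra A] [NonUnitalCStarAlgebra B]
  [NonUnitalCStarAlgebra D]

/-- The coordinate representations of `A ⊗ B`. -/
def coordRep (p : SpatialIndex A B) : Rep (A ⊗ₛ B) where
  H := HilbertTensor p.left.H p.right.H
  π :=
    { toFun := fun x => (x.1 : lp _ _).1 p
      map_smul' := fun _ _ => rfl
      map_zero' := rfl
      map_add' := fun _ _ => rfl
      map_mul' := fun _ _ => rfl
      map_star' := fun _ => rfl }

theorem coordRep_ofAlg (p : SpatialIndex A B) (x : A ⊗[ℂ] B) :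
    (coordRep p).π (ofAlg x) = prodRep p.left.π p.right.π x := rfl

theorem coordRep_faithful (x : A ⊗ₛ B) (h : ∀ p, (coordRep p).π x = 0) : x = 0 :=
  Subtype.ext (Subtype.ext (funext h))

/-- The representation `π ⊗ σ` of `A ⊗ B`. -/
def prodRepHom (R : Rep A) (S : Rep B) :
    A ⊗ₛ B →⋆ₙₐ[ℂ] (HilbertTensor R.H S.H →L[ℂ] HilbertTensor R.H S.H) :=
  liftHom ofAlg denseRange_ofAlg (prodRep R.π S.π) (norm_prodRep_le R S)

theorem prodRepHom_ofAlg (R : Rep A) (S : Rep B) (x : A ⊗[ℂ] B) :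
    prodRepHom R S (ofAlg x) = prodRep R.π S.π x :=
  by unfold prodRepHom; exact liftHom_apply _ _ _ _ _

/-- The canonical map `(A ⊙ B) ⊙ D → (A ⊗ B) ⊙ D`. -/
def algLeft : ((A ⊗[ℂ] B) ⊗[ℂ] D) →ₗ[ℂ] (A ⊗ₛ B) ⊗[ℂ] D :=
  TensorProduct.map ((ofAlg : (A ⊗[ℂ] B) →⋆ₙₐ[ℂ] A ⊗ₛ B) : (A ⊗[ℂ] B) →ₗ[ℂ] A ⊗ₛ B)
    LinearMap.id

/-- The canonical map `(A ⊙ B) ⊙ D → A ⊙ (B ⊗ D)`. -/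
def algRight : ((A ⊗[ℂ] B) ⊗[ℂ] D) →ₗ[ℂ] A ⊗[ℂ] (B ⊗ₛ D) :=
  TensorProduct.map LinearMap.id
    ((ofAlg : (B ⊗[ℂ] D) →⋆ₙₐ[ℂ] B ⊗ₛ D) : (B ⊗[ℂ] D) →ₗ[ℂ] B ⊗ₛ D) ∘ₗ
    (TensorProduct.assoc ℂ A B D).toLinearMap

theorem algRight_tmul (a : A) (b : B) (d : D) :
    algRight ((a ⊗ₜ[ℂ] b) ⊗ₜ[ℂ] d) = a ⊗ₜ[ℂ] ofAlg (b ⊗ₜ[ℂ] d) := rfl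

/-- The canonical map `(A ⊙ B) ⊙ D → (A ⊗ B) ⊗ D`. -/
def ofAlgLeft : ((A ⊗[ℂ] B) ⊗[ℂ] D) →ₗ[ℂ] (A ⊗ₛ B) ⊗ₛ D :=
  ((ofAlg : ((A ⊗ₛ B) ⊗[ℂ] D) →⋆ₙₐ[ℂ] (A ⊗ₛ B) ⊗ₛ D) :
    ((A ⊗ₛ B) ⊗[ℂ] D) →ₗ[ℂ] (A ⊗ₛ B) ⊗ₛ D) ∘ₗ algLeft

/-- The canonical map `(A ⊙ B) ⊙ D → A ⊗ (B ⊗ D)`. -/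
def ofAlgRight : ((A ⊗[ℂ] B) ⊗[ℂ] D) →ₗ[ℂ] A ⊗ₛ (B ⊗ₛ D) :=
  ((ofAlg : (A ⊗[ℂ] (B ⊗ₛ D)) →⋆ₙₐ[ℂ] A ⊗ₛ (B ⊗ₛ D)) :
    (A ⊗[ℂ] (B ⊗ₛ D)) →ₗ[ℂ] A ⊗ₛ (B ⊗ₛ D)) ∘ₗ algRight

/-- Bounded operators on a triple tensor product that agree on elementary tensors agree. -/
theorem op_ext₃ {H K L E : Type*} [NormedAddCommGroup H] [InnerProductSpace ℂ H]
    [NormedAddCommGroup K] [InnerProductSpace ℂ K] [NormedAddCommGroup L] [InnerProductSpace ℂ L]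
    [NormedAddCommGroup E] [NormedSpace ℂ E]
    {S T : HilbertTensor (HilbertTensor H K) L →L[ℂ] E}
    (h : ∀ (x : H) (y : K) (z : L), S (hilbertEmb (hilbertEmb (x ⊗ₜ[ℂ] y) ⊗ₜ[ℂ] z)) =
      T (hilbertEmb (hilbertEmb (x ⊗ₜ[ℂ] y) ⊗ₜ[ℂ] z))) : S = T := by
  ext z
  refine denseRange_assocEmbLeft.induction_on (p := fun z => S z = T z) z ?_ fun x => ?_
  · apply isClosed_eq <;> fun_prop
  · induction x using TensorProduct.induction_on with
    | zero => rw [LinearIsometry.map_zero, map_zero, map_zero]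
    | add x y hx hy => rw [LinearIsometry.map_add, map_add, map_add, hx, hy]
    | tmul x l =>
      rw [assocEmbLeft_tmul]
      induction x using TensorProduct.induction_on with
      | zero => rw [map_zero, TensorProduct.zero_tmul, map_zero, map_zero, map_zero]
      | add x y hx hy => rw [map_add, TensorProduct.add_tmul, map_add, map_add, map_add, hx, hy]
      | tmul x y => exact h x y l

theorem hilbertAssoc_conj (R : Rep A) (S : Rep B) (T : Rep D) (x : (A ⊗[ℂ] B) ⊗[ℂ] D)
    (w : HilbertTensor (HilbertTensor R.H S.H) T.H) :
    hilbertAssoc R.H S.H T.H (prodRep (prodRepHom R S) T.π (algLeft x) w) =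
      prodRep R.π (prodRepHom S T) (algRight x) (hilbertAssoc R.H S.H T.H w) := by
  induction x using TensorProduct.induction_on with
  | zero =>
    rw [map_zero, map_zero, map_zero, map_zero, zero_apply, zero_apply]
    exact map_zero (hilbertAssoc R.H S.H T.H)
  | add x y hx hy =>
    rw [map_add, map_add, map_add, map_add, add_apply, add_apply, ← hx, ← hy]
    exact map_add (hilbertAssoc R.H S.H T.H) _ _
  | tmul x d =>
    induction x using TensorProduct.induction_on with
    | zero =>
      rw [TensorProduct.zero_tmul, map_zero, map_zero, map_zero, map_zero, zero_apply, zero_apply]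
      exact map_zero (hilbertAssoc R.H S.H T.H)
    | add x y hx hy =>
      rw [TensorProduct.add_tmul, map_add, map_add, map_add, map_add, add_apply, add_apply, ← hx,
        ← hy]
      exact map_add (hilbertAssoc R.H S.H T.H) _ _
    | tmul a b =>
      have e1 : prodRep (prodRepHom R S) T.π (algLeft ((a ⊗ₜ[ℂ] b) ⊗ₜ[ℂ] d)) =
          opTensor (opTensor (R.π a) (S.π b)) (T.π d) := by
        change opTensor ((prodRepHom R S) (ofAlg (a ⊗ₜ[ℂ] b))) (T.π d) = _
        rw [prodRepHom_ofAlg, prodRep_tmul]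
      have e2 : prodRep R.π (prodRepHom S T) (algRight ((a ⊗ₜ[ℂ] b) ⊗ₜ[ℂ] d)) =
          opTensor (R.π a) (opTensor (S.π b) (T.π d)) := by
        change opTensor (R.π a) ((prodRepHom S T) (ofAlg (b ⊗ₜ[ℂ] d))) = _
        rw [prodRepHom_ofAlg, prodRep_tmul]
      rw [e1, e2]
      let J : HilbertTensor (HilbertTensor R.H S.H) T.H →L[ℂ]
        HilbertTensor R.H (HilbertTensor S.H T.H) := hilbertAssoc R.H S.H T.H
      have hJ : J.comp (opTensor (opTensor (R.π a) (S.π b)) (T.π d)) =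
          (opTensor (R.π a) (opTensor (S.π b) (T.π d))).comp J := by
        refine op_ext₃ fun h k l => ?_
        change hilbertAssoc R.H S.H T.H (opTensor (opTensor (R.π a) (S.π b)) (T.π d) _) =
          opTensor (R.π a) (opTensor (S.π b) (T.π d)) (hilbertAssoc R.H S.H T.H _)
        rw [opTensor_tmul, opTensor_tmul, hilbertAssoc_tmul, hilbertAssoc_tmul, opTensor_tmul,
          opTensor_tmul]
      exact congrArg (fun φ : HilbertTensor (HilbertTensor R.H S.H) T.H →L[ℂ]
        HilbertTensor R.H (HilbertTensor S.H T.H) => φ w) hJ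

theorem norm_prodRep_assoc_le (R : Rep A) (S : Rep B) (T : Rep D) (x : (A ⊗[ℂ] B) ⊗[ℂ] D) :
    ‖prodRep R.π (prodRepHom S T) (algRight x)‖ ≤ ‖ofAlgLeft x‖ := by
  refine ContinuousLinearMap.opNorm_le_bound _ (norm_nonneg _) fun v => ?_
  obtain ⟨w, rfl⟩ := (hilbertAssoc R.H S.H T.H).surjective v
  rw [← hilbertAssoc_conj, LinearIsometryEquiv.norm_map, LinearIsometryEquiv.norm_map]
  exact ContinuousLinearMap.le_of_opNorm_le _ (norm_prodRep_le ⟨_, prodRepHom R S⟩ T _) w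

theorem coordRep_eq (p : SpatialIndex A B) (x : A ⊗ₛ B) :
    (coordRep p).π x = prodRepHom p.left p.right x := by
  refine denseRange_ofAlg.induction_on
    (p := fun x => (coordRep p).π x = prodRepHom p.left p.right x) x ?_ fun x => ?_
  · exact isClosed_eq (star_hom_continuous (coordRep p).π)
      (star_hom_continuous (prodRepHom p.left p.right))
  · rw [prodRepHom_ofAlg, coordRep_ofAlg]

theorem norm_assoc_le (x : (A ⊗[ℂ] B) ⊗[ℂ] D) :
    ‖ofAlgRight x‖ ≤ ‖ofAlgLeft x‖ := by
  change ‖ofAlg (algRight x)‖ ≤ _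
  refine norm_ofAlg_le (norm_nonneg _) fun R S => ?_
  refine norm_prodRep_le_of_family R S (fun p : SpatialIndex B D => ⟨_, prodRepHom p.left p.right⟩)
    (fun b hb => coordRep_faithful b fun p => (coordRep_eq p b).trans (hb p)) _ (norm_nonneg _)
    fun p => norm_prodRep_assoc_le R p.left p.right x

theorem denseRange_ofAlgLeft :
    DenseRange (ofAlgLeft : ((A ⊗[ℂ] B) ⊗[ℂ] D) →ₗ[ℂ] (A ⊗ₛ B) ⊗ₛ D) := by
  have h1 : Dense (Submodule.span ℂ (Set.range
      (ofAlg : (A ⊗[ℂ] B) →⋆ₙₐ[ℂ] A ⊗ₛ B)) : Set (A ⊗ₛ B)) :=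
    denseRange_ofAlg.mono Submodule.subset_span
  have h2 : Dense (Submodule.span ℂ (Set.univ : Set D) : Set D) :=
    dense_univ.mono Submodule.subset_span
  refine dense_of_tmul_mem h1 h2 (LinearMap.range
    (ofAlgLeft : ((A ⊗[ℂ] B) ⊗[ℂ] D) →ₗ[ℂ] (A ⊗ₛ B) ⊗ₛ D)) ?_
  rintro _ ⟨x, rfl⟩ d -
  exact ⟨x ⊗ₜ[ℂ] d, rfl⟩

/-- The associativity map, as a continuous linear map. -/
def assocCLM (A B D : Type u) [NonUnitalCStarAlgebra A] [NonUnitalCStarAlgebra B]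
    [NonUnitalCStarAlgebra D] : (A ⊗ₛ B) ⊗ₛ D →L[ℂ] A ⊗ₛ (B ⊗ₛ D) :=
  ofAlgRight.extendOfNorm ofAlgLeft

theorem assocCLM_tmul (a : A) (b : B) (d : D) :
    assocCLM A B D (tmul (tmul a b) d) = tmul a (tmul b d) :=
  LinearMap.extendOfNorm_eq (f := (ofAlgRight : ((A ⊗[ℂ] B) ⊗[ℂ] D) →ₗ[ℂ] A ⊗ₛ (B ⊗ₛ D)))
    (e := (ofAlgLeft : ((A ⊗[ℂ] B) ⊗[ℂ] D) →ₗ[ℂ] (A ⊗ₛ B) ⊗ₛ D)) denseRange_ofAlgLeft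
    ⟨1, fun x => by rw [one_mul]; exact norm_assoc_le x⟩ ((a ⊗ₜ[ℂ] b) ⊗ₜ[ℂ] d)

/-- Continuous linear maps that agree on elementary triple tensors agree. -/
theorem tensor_ext₃ {E : Type*} [NormedAddCommGroup E] [NormedSpace ℂ E]
    {S T : (A ⊗ₛ B) ⊗ₛ D →L[ℂ] E}
    (h : ∀ a b d, S (tmul (tmul a b) d) = T (tmul (tmul a b) d)) : S = T := by
  refine tensor_ext fun z d => ?_
  let τ : A ⊗ₛ B →L[ℂ] (A ⊗ₛ B) ⊗ₛ D :=
    { toFun := fun z => tmul z d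
      map_add' := fun x y => tmul_add_left x y d
      map_smul' := fun c x => tmul_smul_left c x d
      cont := continuous_tmul_left d }
  have : S.comp τ = T.comp τ := tensor_ext fun a b => h a b d
  exact congrArg (fun φ : A ⊗ₛ B →L[ℂ] E => φ z) this

theorem assocCLM_mul (x y : (A ⊗ₛ B) ⊗ₛ D) :
    assocCLM A B D (x * y) = assocCLM A B D x * assocCLM A B D y := by
  have h1 : ∀ (a : A) (b : B) (d : D) (y : (A ⊗ₛ B) ⊗ₛ D),
      assocCLM A B D (tmul (tmul a b) d * y) =
        assocCLM A B D (tmul (tmul a b) d) * assocCLM A B D y := by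
    intro a b d y
    have : (assocCLM A B D).comp (ContinuousLinearMap.mul ℂ _ (tmul (tmul a b) d)) =
        (ContinuousLinearMap.mul ℂ _ (assocCLM A B D (tmul (tmul a b) d))).comp
          (assocCLM A B D) := by
      refine tensor_ext₃ fun a' b' d' => ?_
      simp only [ContinuousLinearMap.comp_apply, ContinuousLinearMap.mul_apply', tmul_mul_tmul,
        assocCLM_tmul]
    exact congrArg (fun φ : (A ⊗ₛ B) ⊗ₛ D →L[ℂ] A ⊗ₛ (B ⊗ₛ D) => φ y) this
  have : (assocCLM A B D).comp ((ContinuousLinearMap.mul ℂ _).flip y) =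
      ((ContinuousLinearMap.mul ℂ _).flip (assocCLM A B D y)).comp (assocCLM A B D) := by
    refine tensor_ext₃ fun a b d => ?_
    simp only [ContinuousLinearMap.comp_apply, ContinuousLinearMap.flip_apply,
      ContinuousLinearMap.mul_apply', h1]
  exact congrArg (fun φ : (A ⊗ₛ B) ⊗ₛ D →L[ℂ] A ⊗ₛ (B ⊗ₛ D) => φ x) this

theorem assocCLM_star (x : (A ⊗ₛ B) ⊗ₛ D) :
    assocCLM A B D (star x) = star (assocCLM A B D x) := by
  let T : (A ⊗ₛ B) ⊗ₛ D →L[ℂ] A ⊗ₛ (B ⊗ₛ D) :=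
    { toFun := fun x => star (assocCLM A B D (star x))
      map_add' := fun x y => by simp only [star_add, map_add]
      map_smul' := fun c x => by simp
      cont := by fun_prop }
  have hT : T = assocCLM A B D := tensor_ext₃ fun a b d => by
    change star (assocCLM A B D (star _)) = _
    rw [star_tmul, star_tmul, assocCLM_tmul, assocCLM_tmul, star_tmul, star_tmul, star_star,
      star_star, star_star]
  rw [← hT]
  change star (assocCLM A B D (star (star x))) = star (T x)
  rw [star_star, hT]

/-- The associativity map `(A ⊗ B) ⊗ D → A ⊗ (B ⊗ D)`. -/
def assocHom (A B D : Type u) [NonUnitalCStarAlgebra A] [NonUnitalCStarAlgebra B]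
    [NonUnitalCStarAlgebra D] : (A ⊗ₛ B) ⊗ₛ D →⋆ₙₐ[ℂ] A ⊗ₛ (B ⊗ₛ D) where
  toFun := assocCLM A B D
  map_smul' c x := map_smul (assocCLM A B D) c x
  map_zero' := map_zero (assocCLM A B D)
  map_add' := map_add (assocCLM A B D)
  map_mul' := assocCLM_mul
  map_star' := assocCLM_star

theorem assocHom_tmul (a : A) (b : B) (d : D) :
    assocHom A B D (tmul (tmul a b) d) = tmul a (tmul b d) := assocCLM_tmul a b d

theorem dense_mul_self : Dense (Submodule.span ℂ {y : A | ∃ a b : A, a * b = y} : Set A) :=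
  fun b => closure_mono (by rintro _ ⟨e, rfl⟩; exact Submodule.subset_span ⟨e, b, rfl⟩)
    (mem_closure_range_mul b)

theorem dense_mul_tmul : Dense (Submodule.span ℂ
    {y : A ⊗ₛ B | ∃ (a : A) (b : B) (a' : A) (b' : B), tmul a b * tmul a' b' = y} :
      Set (A ⊗ₛ B)) := by
  refine dense_of_tmul_mem dense_mul_self dense_mul_self _ ?_
  rintro _ ⟨a, a', rfl⟩ _ ⟨b, b', rfl⟩
  exact Submodule.subset_span ⟨a, b, a', b', tmul_mul_tmul _ _ _ _⟩

/-- The associativity isomorphism, as a morphism. -/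
def Mor.assoc (A B D : Type u) [NonUnitalCStarAlgebra A] [NonUnitalCStarAlgebra B]
    [NonUnitalCStarAlgebra D] : Mor ((A ⊗ₛ B) ⊗ₛ D) (A ⊗ₛ (B ⊗ₛ D)) :=
  Mor.ofHom (assocHom A B D) <| by
    refine dense_of_tmul_mem (dense_mul_self (A := A)) (dense_mul_tmul (A := B) (B := D)) _ ?_
    rintro _ ⟨a, a', rfl⟩ _ ⟨b, d, b', d', rfl⟩
    refine Submodule.subset_span ⟨tmul (tmul a b) d, tmul a' (tmul b' d'), ?_⟩
    rw [assocHom_tmul, tmul_mul_tmul]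

theorem Mor.assoc_hom_tmul (a : A) (b : B) (d : D) :
    (Mor.assoc A B D).hom (tmul (tmul a b) d) = (tmul a (tmul b d) : A ⊗ₛ (B ⊗ₛ D)) :=
  congrArg DoubleCentralizer.coeHom (assocHom_tmul a b d)

end Assoc

section Functoriality

variable {A B A' B' A'' B'' : Type u} [NonUnitalCStarAlgebra A] [NonUnitalCStarAlgebra B]
  [NonUnitalCStarAlgebra A'] [NonUnitalCStarAlgebra B'] [NonUnitalCStarAlgebra A'']
  [NonUnitalCStarAlgebra B'']

/-- Continuous additive maps that agree on elementary tensors agree. -/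
theorem tensor_fun_ext {E : Type*} [NormedAddCommGroup E] {F F' : A ⊗ₛ B → E}
    (hF : Continuous F) (hF' : Continuous F') (h₁ : ∀ x y, F (x + y) = F x + F y)
    (h₂ : ∀ x y, F' (x + y) = F' x + F' y) (h : ∀ a b, F (tmul a b) = F' (tmul a b))
    (y : A ⊗ₛ B) : F y = F' y := by
  refine denseRange_ofAlg.induction_on (p := fun z => F z = F' z) y (isClosed_eq hF hF')
    fun x => ?_
  induction x using TensorProduct.induction_on with
  | zero =>
    have e₁ := h₁ 0 0
    have e₂ := h₂ 0 0
    rw [add_zero, left_eq_add] at e₁ e₂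
    rw [map_zero, e₁, e₂]
  | tmul x y => exact h x y
  | add x y hx hy => rw [map_add, h₁, h₂, hx, hy]

theorem tensorMap_id (y : A ⊗ₛ B) :
    tensorMap (NonUnitalStarAlgHom.id ℂ A) (NonUnitalStarAlgHom.id ℂ B) y = y := by
  refine tensor_fun_ext
    (F := tensorMap (NonUnitalStarAlgHom.id ℂ A) (NonUnitalStarAlgHom.id ℂ B))
    (F' := fun y => y) (star_hom_continuous _) continuous_id (map_add _)
    (fun _ _ => rfl) (fun a b => ?_) y
  rw [tensorMap_tmul]
  rfl

theorem tensorMap_comp (g : A' →⋆ₙₐ[ℂ] A'') (f : A →⋆ₙₐ[ℂ] A') (g' : B' →⋆ₙₐ[ℂ] B'')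
    (f' : B →⋆ₙₐ[ℂ] B') (y : A ⊗ₛ B) :
    tensorMap (g.comp f) (g'.comp f') y = tensorMap g g' (tensorMap f f' y) := by
  refine tensor_fun_ext (F := tensorMap (g.comp f) (g'.comp f'))
    (F' := fun y => tensorMap g g' (tensorMap f f' y)) (star_hom_continuous _)
    ((star_hom_continuous (tensorMap g g')).comp (star_hom_continuous (tensorMap f f')))
    (map_add _) (fun x y => by rw [map_add, map_add]) (fun a b => ?_) y
  rw [tensorMap_tmul, tensorMap_tmul, tensorMap_tmul]
  rfl

theorem homTensor_coe (f : A →⋆ₙₐ[ℂ] A') (g : B →⋆ₙₐ[ℂ] B') (y : A ⊗ₛ B) :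
    homTensor (DoubleCentralizer.coeHom.comp f) (DoubleCentralizer.coeHom.comp g) y =
      ((tensorMap f g y : A' ⊗ₛ B') : 𝓜(ℂ, A' ⊗ₛ B')) := by
  refine tensor_fun_ext
    (F := homTensor (DoubleCentralizer.coeHom.comp f) (DoubleCentralizer.coeHom.comp g))
    (F' := fun y => DoubleCentralizer.coeHom (tensorMap f g y)) (star_hom_continuous _)
    ((star_hom_continuous DoubleCentralizer.coeHom).comp (star_hom_continuous (tensorMap f g)))
    (map_add _) (fun x y => by rw [map_add, map_add]) (fun a b => ?_) y
  refine mult_tensor_ext fun a' b' => ?_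
  rw [homTensor_tmul_fst, tensorMap_tmul]
  exact (tmul_mul_tmul _ _ _ _).symm

end Functoriality

section Slices

variable {C A : Type u} [NonUnitalCStarAlgebra C] [NonUnitalCStarAlgebra A]

/-- `y = (ω ⊗ id)(X)` for a bounded functional `ω` on `C`, a multiplier `X` of `C ⊗ A` and a
multiplier `y` of `A`. Here `ω = ω'(· c)`, as every bounded functional is, `S` is the slice map
`ω' ⊗ id : C ⊗ A → A`, and `y a = (ω' ⊗ id)(X (c ⊗ a))`. -/
def IsLeftSlice (ω : C →L[ℂ] ℂ) (X : 𝓜(ℂ, C ⊗ₛ A)) (y : 𝓜(ℂ, A)) : Prop :=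
  ∃ (ω' : C →L[ℂ] ℂ) (c : C) (S : C ⊗ₛ A →L[ℂ] A), (∀ d, ω d = ω' (d * c)) ∧
    (∀ d a, S (tmul d a) = ω' d • a) ∧ ∀ a, y.fst a = S (X.fst (tmul c a))

/-- `y = (id ⊗ ω)(X)` for a bounded functional `ω` on `C`, a multiplier `X` of `A ⊗ C` and a
multiplier `y` of `A`. -/
def IsRightSlice (ω : C →L[ℂ] ℂ) (X : 𝓜(ℂ, A ⊗ₛ C)) (y : 𝓜(ℂ, A)) : Prop :=
  ∃ (ω' : C →L[ℂ] ℂ) (c : C) (S : A ⊗ₛ C →L[ℂ] A), (∀ d, ω d = ω' (d * c)) ∧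
    (∀ a d, S (tmul a d) = ω' d • a) ∧ ∀ a, y.fst a = S (X.fst (tmul a c))

end Slices

section Weights

/-- Positive elements of a C*-algebra. -/
def IsPos {A : Type u} [NonUnitalCStarAlgebra A] (a : A) : Prop := ∃ x : A, a = star x * x

/-- Positive functionals on a C*-algebra. -/
def IsPosFunctional {A : Type u} [NonUnitalCStarAlgebra A] (ω : A →L[ℂ] ℂ) : Prop :=
  ∀ x : A, ∃ t : ℝ, 0 ≤ t ∧ ω (star x * x) = t

/-- A proper weight on a C*-algebra: a map on the positive elements with values in `[0, ∞]` that is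
additive, positively homogeneous, non-zero, densely defined and lower semicontinuous. Its values
outside the positive elements play no role. -/
structure Weight (A : Type u) [NonUnitalCStarAlgebra A] where
  toFun : A → ℝ≥0∞
  add : ∀ a b, IsPos a → IsPos b → toFun (a + b) = toFun a + toFun b
  smul : ∀ (t : ℝ) (a : A), 0 ≤ t → IsPos a → toFun ((t : ℂ) • a) = ENNReal.ofReal t * toFun a
  nonzero : ∃ a, IsPos a ∧ toFun a ≠ 0
  denselyDefined : {a | IsPos a} ⊆ closure {a | IsPos a ∧ toFun a < ∞}
  lowerSemicontinuous : LowerSemicontinuousOn toFun {a | IsPos a}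

variable {A : Type u} [NonUnitalCStarAlgebra A]

/-- The left ideal of the elements `a` with `φ(a* a) < ∞`. -/
def Weight.leftIdeal (φ : Weight A) : Set A := {a | φ.toFun (star a * a) < ∞}

/-- A GNS construction `(H, π, Λ)` for a weight `φ`. The values of `Λ` outside the left ideal of
`φ` play no role; the inner products `⟪Λ a, Λ b⟫ = φ(a* b)` are determined by `norm_Λ` through
polarization. -/
structure Weight.GNS (φ : Weight A) extends Rep A where
  Λ : A → H
  Λ_add : ∀ a ∈ φ.leftIdeal, ∀ b ∈ φ.leftIdeal, Λ (a + b) = Λ a + Λ b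
  Λ_smul : ∀ (c : ℂ), ∀ a ∈ φ.leftIdeal, Λ (c • a) = c • Λ a
  norm_Λ : ∀ a ∈ φ.leftIdeal, ENNReal.ofReal (‖Λ a‖ ^ 2) = φ.toFun (star a * a)
  dense_Λ : Dense (Λ '' φ.leftIdeal)
  π_Λ : ∀ x : A, ∀ a ∈ φ.leftIdeal, π x (Λ a) = Λ (x * a)

/-- Sequences of vectors that give a normal positive functional `θ = ∑ ⟨ξₙ, · ξₙ⟩` with
`θ ∘ π ≤ φ` on the positive elements. -/
def Weight.GNS.IsDominated {φ : Weight A} (g : φ.GNS) (ξ : ℕ → g.H) : Prop :=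
  Summable (fun n => ‖ξ n‖ ^ 2) ∧
    ∀ a : A, ∑' n, ENNReal.ofReal (‖g.π a (ξ n)‖ ^ 2) ≤ φ.toFun (star a * a)

/-- The lift of a weight `φ` to the von Neumann algebra generated by the GNS representation: its
value at a positive operator `x` is the supremum of `θ(x)` over all normal positive functionals `θ`
with `θ ∘ π ≤ φ`. -/
def Weight.GNS.lift {φ : Weight A} (g : φ.GNS) (x : g.H →L[ℂ] g.H) : ℝ≥0∞ :=
  ⨆ ξ : {ξ : ℕ → g.H // g.IsDominated ξ}, ∑' n, ENNReal.ofReal (⟪ξ.1 n, x (ξ.1 n)⟫_ℂ).re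

/-- The von Neumann algebra generated by the GNS representation: the bicommutant. -/
def Weight.GNS.vonNeumann {φ : Weight A} (g : φ.GNS) : Set (g.H →L[ℂ] g.H) :=
  Set.centralizer (Set.centralizer (Set.range g.π))

/-- A proper weight is approximately KMS if its lift to the von Neumann algebra generated by the
GNS representation is faithful. -/
def Weight.IsApproximatelyKMS (φ : Weight A) : Prop :=
  ∃ g : φ.GNS, ∀ y ∈ g.vonNeumann, g.lift (star y * y) = 0 → y = 0

/-- Left invariance: `φ((ω ⊗ id)Δ(a)) = ω(1) φ(a)` for every positive functional `ω` and every
positive `a` with `φ(a) < ∞`, where `ω(1) = ‖ω‖`. -/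
def Weight.IsLeftInvariant (φ : Weight A) (Δ : Mor A (A ⊗ₛ A)) : Prop :=
  ∀ (ω : A →L[ℂ] ℂ) (a y : A), IsPosFunctional ω → IsPos a → φ.toFun a < ∞ →
    IsLeftSlice ω (Δ.hom a) y → φ.toFun y = ENNReal.ofReal ‖ω‖ * φ.toFun a

/-- Right invariance: `φ((id ⊗ ω)Δ(a)) = ω(1) φ(a)`. -/
def Weight.IsRightInvariant (φ : Weight A) (Δ : Mor A (A ⊗ₛ A)) : Prop :=
  ∀ (ω : A →L[ℂ] ℂ) (a y : A), IsPosFunctional ω → IsPos a → φ.toFun a < ∞ →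
    IsRightSlice ω (Δ.hom a) y → φ.toFun y = ENNReal.ofReal ‖ω‖ * φ.toFun a

end Weights

/-- A locally compact quantum group, given by the C*-algebra `C = C₀(G)` with its
comultiplication. -/
structure LCQG where
  C : Type u
  [alg : NonUnitalCStarAlgebra C]
  Δ : Mor C (C ⊗ₛ C)
  coassoc : (Mor.assoc C C C).comp ((Δ.tensor (Mor.id C)).comp Δ) = ((Mor.id C).tensor Δ).comp Δ
  leftSlice_mem : ∀ (ω : C →L[ℂ] ℂ) (a : C), ∃ y : C, IsLeftSlice ω (Δ.hom a) y
  leftSlice_dense : Dense (Submodule.span ℂ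
    {y : C | ∃ (ω : C →L[ℂ] ℂ) (a : C), IsLeftSlice ω (Δ.hom a) y} : Set C)
  rightSlice_mem : ∀ (ω : C →L[ℂ] ℂ) (a : C), ∃ y : C, IsRightSlice ω (Δ.hom a) y
  rightSlice_dense : Dense (Submodule.span ℂ
    {y : C | ∃ (ω : C →L[ℂ] ℂ) (a : C), IsRightSlice ω (Δ.hom a) y} : Set C)
  exists_leftHaar : ∃ φ : Weight C, φ.IsApproximatelyKMS ∧ φ.IsLeftInvariant Δ
  exists_rightHaar : ∃ ψ : Weight C, ψ.IsApproximatelyKMS ∧ ψ.IsRightInvariant Δ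

attribute [instance] LCQG.alg

variable {G : LCQG.{u}}

/-- The multiplier `c ⊗ 1` of `C₀(G) ⊗ A`. -/
def LCQG.leg (G : LCQG.{u}) (A : Type u) [NonUnitalCStarAlgebra A] (c : G.C) :
    𝓜(ℂ, G.C ⊗ₛ A) :=
  multTmul (c : 𝓜(ℂ, G.C)) 1

/-- An action of a locally compact quantum group `G` on a C*-algebra `A`: a non-degenerate
`*`-homomorphism `ρ : A → M(C₀(G) ⊗ A)` with `(id ⊗ ρ)ρ = (Δ ⊗ id)ρ`, such that `ρ(A)(C₀(G) ⊗ 1)`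
and `(C₀(G) ⊗ 1)ρ(A)` are contained in `C₀(G) ⊗ A` and the former has dense linear span there. -/
structure QuantumAction (G : LCQG.{u}) (A : Type u) [NonUnitalCStarAlgebra A] where
  mor : Mor A (G.C ⊗ₛ A)
  coassoc : ((Mor.id G.C).tensor mor).comp mor =
    (Mor.assoc G.C G.C A).comp ((G.Δ.tensor (Mor.id A)).comp mor)
  mul_leg_mem : ∀ (a : A) (c : G.C), ∃ y : G.C ⊗ₛ A,
    mor.hom a * G.leg A c = (y : 𝓜(ℂ, G.C ⊗ₛ A))
  leg_mul_mem : ∀ (a : A) (c : G.C), ∃ y : G.C ⊗ₛ A,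
    G.leg A c * mor.hom a = (y : 𝓜(ℂ, G.C ⊗ₛ A))
  dense : Dense (Submodule.span ℂ {y : G.C ⊗ₛ A | ∃ (a : A) (c : G.C),
    mor.hom a * G.leg A c = (y : 𝓜(ℂ, G.C ⊗ₛ A))} : Set (G.C ⊗ₛ A))

section Equivariance

variable {A B D : Type u} [NonUnitalCStarAlgebra A] [NonUnitalCStarAlgebra B]
  [NonUnitalCStarAlgebra D]

/-- The map `id ⊗ f : C₀(G) ⊗ A → M(C₀(G) ⊗ B)` for a (possibly degenerate) `*`-homomorphism
`f : A → M(B)`. -/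
def LCQG.idTensor (G : LCQG.{u}) (f : A →⋆ₙₐ[ℂ] 𝓜(ℂ, B)) :
    G.C ⊗ₛ A →⋆ₙₐ[ℂ] 𝓜(ℂ, G.C ⊗ₛ B) :=
  homTensor DoubleCentralizer.coeHom f

/-- Equivariance of a (possibly degenerate) `*`-homomorphism `f : A → M(B)`, that is,
`ρ_B(f(a)) = (id ⊗ f)(ρ_A(a))`. The multiplier `(id ⊗ f)(x)`, for `x` with `x (c ⊗ 1)` in
`C₀(G) ⊗ A` for all `c`, is determined by `(id ⊗ f)(x) (c ⊗ 1) = (id ⊗ f)(x (c ⊗ 1))`. -/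
def IsEquivariant (ρA : QuantumAction G A) (ρB : QuantumAction G B) (f : A →⋆ₙₐ[ℂ] 𝓜(ℂ, B)) :
    Prop :=
  ∀ (a : A) (c : G.C) (y : G.C ⊗ₛ A), ρA.mor.hom a * G.leg A c = (y : 𝓜(ℂ, G.C ⊗ₛ A)) →
    ρB.mor.extend (f a) * G.leg B c = G.idTensor f y

/-- Equivariance of a `*`-homomorphism `A → B ⊆ M(B)`. -/
def IsEquivariantHom (ρA : QuantumAction G A) (ρB : QuantumAction G B) (f : A →⋆ₙₐ[ℂ] B) : Prop :=
  IsEquivariant ρA ρB (DoubleCentralizer.coeHom.comp f)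

theorem idTensor_coe (f : A →⋆ₙₐ[ℂ] B) (y : G.C ⊗ₛ A) :
    G.idTensor (DoubleCentralizer.coeHom.comp f) y =
      ((tensorMap (NonUnitalStarAlgHom.id ℂ G.C) f y : G.C ⊗ₛ B) : 𝓜(ℂ, G.C ⊗ₛ B)) :=
  homTensor_coe (NonUnitalStarAlgHom.id ℂ G.C) f y

theorem isEquivariantHom_iff (ρA : QuantumAction G A) (ρB : QuantumAction G B)
    (f : A →⋆ₙₐ[ℂ] B) : IsEquivariantHom ρA ρB f ↔ ∀ (a : A) (c : G.C) (y : G.C ⊗ₛ A),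
      ρA.mor.hom a * G.leg A c = (y : 𝓜(ℂ, G.C ⊗ₛ A)) →
      ρB.mor.hom (f a) * G.leg B c =
        ((tensorMap (NonUnitalStarAlgHom.id ℂ G.C) f y : G.C ⊗ₛ B) : 𝓜(ℂ, G.C ⊗ₛ B)) := by
  refine forall_congr' fun a => forall_congr' fun c => forall_congr' fun y =>
    imp_congr_right fun _ => ?_
  rw [idTensor_coe, ← ρB.mor.extend_coe]
  rfl

theorem IsEquivariantHom.id (ρA : QuantumAction G A) :
    IsEquivariantHom ρA ρA (NonUnitalStarAlgHom.id ℂ A) := by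
  rw [isEquivariantHom_iff]
  intro a c y h
  rw [tensorMap_id]
  exact h

theorem IsEquivariantHom.comp {ρA : QuantumAction G A} {ρB : QuantumAction G B}
    {ρD : QuantumAction G D} {g : B →⋆ₙₐ[ℂ] D} {f : A →⋆ₙₐ[ℂ] B}
    (hg : IsEquivariantHom ρB ρD g) (hf : IsEquivariantHom ρA ρB f) :
    IsEquivariantHom ρA ρD (g.comp f) := by
  rw [isEquivariantHom_iff] at hf hg ⊢
  intro a c y h
  have h2 := hg (f a) c _ (hf a c y h)
  have := tensorMap_comp (NonUnitalStarAlgHom.id ℂ G.C) (NonUnitalStarAlgHom.id ℂ G.C) g f y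
  exact h2.trans (congrArg DoubleCentralizer.coeHom this.symm)

end Equivariance

section Compactification

variable {A : Type u} [NonUnitalCStarAlgebra A]

/-- An equivariant compactification `(B, ℓ, r, ρ_B)` of an action `ρ` on `A`: a unital C*-algebra
`B` with an action `ρ_B`, an equivariant `*`-homomorphism `ℓ : A → B` and an equivariant unital
`*`-homomorphism `r : B → M(A)` whose composite is the canonical inclusion `A → M(A)`. -/
structure EquivariantCompactification (ρ : QuantumAction G A) where
  B : Type u
  [alg : CStarAlgebra B]
  ℓ : A →⋆ₙₐ[ℂ] B
  r : B →⋆ₐ[ℂ] 𝓜(ℂ, A)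
  r_ℓ : ∀ a : A, r (ℓ a) = (a : 𝓜(ℂ, A))
  ρB : QuantumAction G B
  equivariant_ℓ : IsEquivariantHom ρ ρB ℓ
  equivariant_r : IsEquivariant ρB ρ (r : B →⋆ₙₐ[ℂ] 𝓜(ℂ, A))
  equivariant_incl : IsEquivariant ρ ρ DoubleCentralizer.coeHom

attribute [instance] EquivariantCompactification.alg

namespace EquivariantCompactification

variable {ρ : QuantumAction G A}

/-- Morphisms of equivariant compactifications: equivariant unital `*`-homomorphisms compatible
with the maps from `A` and to `M(A)`. -/
@[ext]
structure Hom (X Y : EquivariantCompactification ρ) where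
  f : X.B →⋆ₐ[ℂ] Y.B
  f_ℓ : ∀ a : A, f (X.ℓ a) = Y.ℓ a
  r_f : ∀ b : X.B, Y.r (f b) = X.r b
  equivariant : IsEquivariantHom X.ρB Y.ρB (f : X.B →⋆ₙₐ[ℂ] Y.B)

/-- The identity morphism. -/
def Hom.id (X : EquivariantCompactification ρ) : Hom X X where
  f := StarAlgHom.id ℂ X.B
  f_ℓ _ := rfl
  r_f _ := rfl
  equivariant := IsEquivariantHom.id X.ρB

/-- Composition of morphisms. -/
def Hom.comp {X Y Z : EquivariantCompactification ρ} (f : Hom X Y) (g : Hom Y Z) : Hom X Z where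
  f := g.f.comp f.f
  f_ℓ a := (congrArg g.f (f.f_ℓ a)).trans (g.f_ℓ a)
  r_f b := (g.r_f (f.f b)).trans (f.r_f b)
  equivariant := by
    have e : ((g.f.comp f.f : X.B →⋆ₐ[ℂ] Z.B) : X.B →⋆ₙₐ[ℂ] Z.B) =
        (g.f : Y.B →⋆ₙₐ[ℂ] Z.B).comp (f.f : X.B →⋆ₙₐ[ℂ] Y.B) :=
      NonUnitalStarAlgHom.ext fun _ => rfl
    rw [e]
    exact IsEquivariantHom.comp g.equivariant f.equivariant

/-- The category of equivariant compactifications of an action. -/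
instance : CategoryTheory.Category (EquivariantCompactification ρ) where
  Hom := Hom
  id := Hom.id
  comp := Hom.comp
  id_comp f := Hom.ext (StarAlgHom.ext fun _ => rfl)
  comp_id f := Hom.ext (StarAlgHom.ext fun _ => rfl)
  assoc f g h := Hom.ext (StarAlgHom.ext fun _ => rfl)

end EquivariantCompactification

end Compactification

end QuantumCompactification

end

/-!
The terminal object is carried by a subalgebra of `M(A)`. Call a set `S` of multipliers of `A`
*Podleś* if `ρ(S)(C₀(G) ⊗ 1)` and `C₀(G) ⊗ S` have the same closed linear span in `M(C₀(G) ⊗ A)`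
(`IsPodles`).

* The image of any equivariant `*`-homomorphism into `M(A)` is Podleś
  (`IsEquivariant.isPodles_range`). In particular `A` itself is, and so is `r(B)` for every
  equivariant compactification `(B, ℓ, r, ρ_B)`.
* The unital C*-algebra generated by any family of self-adjoint Podleś sets is Podleś
  (`IsPodles.topologicalClosure_adjoin`): the elements `d` with `ρ(d)(C₀(G) ⊗ 1)` in the closed span
  of `C₀(G) ⊗ D`, and those with `C₀(G) ⊗ d` in the closed span of `ρ(D)(C₀(G) ⊗ 1)`, are closed
  under products, because `1 ⊗ D` multiplies the first span into itself and `ρ(D)` the second. Hence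
  there is a greatest Podleś C*-subalgebra `D` of `M(A)` (`greatestPodles`), and it contains `A` and
  all the `r(B)`.
* A Podleś C*-subalgebra `D` with inclusion `ι` carries an action (`restrictAction`). The map
  `id ⊗ ι : C₀(G) ⊗ D → M(C₀(G) ⊗ A)` is isometric, its image is the closed span of `C₀(G) ⊗ D`, and
  left multiplication by `ρ(d)` preserves this image, which defines a multiplier of `C₀(G) ⊗ D`.
  Coassociativity follows from that of `ρ` since `id ⊗ id ⊗ ι` is a monomorphism.

The only analytic input is that `id ⊗ ι` is isometric (`norm_homTensor_coe`). Representations of `A`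
are jointly faithful by Hahn–Banach separation from the positive cone and the GNS construction
(`exists_rep_ne_zero`), so their extensions to `M(A)`, restricted to `D`, are jointly faithful on
`D`, and any jointly faithful family computes the spatial norm.

The map from a compactification `(B, ℓ, r, ρ_B)` to the one on `greatestPodles ρ` is `r`
corestricted; it is the only one, because the inclusion of `greatestPodles ρ` in `M(A)` is
injective.
-/

namespace QuantumCompactification

/-! ### Faithful families of representations -/

section Faithful

open scoped ComplexOrder

variable {A : Type u} [NonUnitalCStarAlgebra A]

/-- Hahn–Banach separation of `-a` from the closed cone of positive elements gives a real
functional; it is made complex linear after composing with the real part, so that it stays positive. -/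
theorem exists_positiveLinearMap_ne_zero [PartialOrder A] [StarOrderedRing A] {a : A}
    (ha : 0 ≤ a) (ha' : a ≠ 0) : ∃ F : A →ₚ[ℂ] ℂ, F a ≠ 0 := by
  have hna : -a ∉ ProperCone.positive ℝ A := by
    intro h
    exact ha' (le_antisymm (neg_nonneg.mp h) ha)
  obtain ⟨f, hf, hfa⟩ := (ProperCone.positive ℝ A).hyperplane_separation_point hna
  let g : Module.Dual ℝ A := (f : A →ₗ[ℝ] ℝ) ∘ₗ
    (selfAdjoint.submodule ℝ A).subtype ∘ₗ realPart
  have hg : ∀ x : A, IsSelfAdjoint x → (g.extendRCLike : Module.Dual ℂ A) x = (f x : ℂ) := by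
    intro x hx
    have h1 : g x = f x := congrArg f hx.coe_realPart
    have h2 : g (Complex.I • x) = 0 := by
      change f ((realPart (Complex.I • x) : selfAdjoint A) : A) = 0
      rw [realPart_I_smul, hx.imaginaryPart]
      simp
    rw [Module.Dual.extendRCLike_apply]
    change ((g x : ℝ) : ℂ) - Complex.I * ((g (Complex.I • x) : ℝ) : ℂ) = _
    rw [h1, h2]
    simp
  refine ⟨PositiveLinearMap.mk₀ (g.extendRCLike : Module.Dual ℂ A) fun x hx => ?_, ?_⟩
  · rw [hg x (IsSelfAdjoint.of_nonneg hx)]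
    exact_mod_cast hf x hx
  · change (g.extendRCLike : Module.Dual ℂ A) a ≠ 0
    rw [hg a (IsSelfAdjoint.of_nonneg ha)]
    rw [map_neg] at hfa
    have : f a ≠ 0 := by intro h; simp [h] at hfa
    exact_mod_cast this

/-- The representations of a C*-algebra are jointly faithful. For `a ≠ 0` a positive functional `F`
with `F((a a*)²) ≠ 0` is used: in its GNS space `a` moves the vector of `a*`. -/
theorem exists_rep_ne_zero {a : A} (ha : a ≠ 0) : ∃ R : Rep A, R.π a ≠ 0 := by
  let _ := CStarAlgebra.spectralOrder A
  have _ := CStarAlgebra.spectralOrderedRing A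
  have h1 : a * star a ≠ 0 := fun h => ha (CStarRing.mul_star_self_eq_zero_iff a |>.mp h)
  have h2 : star (a * star a) * (a * star a) ≠ 0 :=
    fun h => h1 (CStarRing.star_mul_self_eq_zero_iff _ |>.mp h)
  obtain ⟨F, hF⟩ := exists_positiveLinearMap_ne_zero (star_mul_self_nonneg (a * star a)) h2
  refine ⟨⟨F.GNS, F.gnsNonUnitalStarAlgHom⟩, fun h => hF ?_⟩
  have h3 : F.gnsNonUnitalStarAlgHom a (F.toPreGNS (star a) : F.GNS) = 0 := by
    rw [show F.gnsNonUnitalStarAlgHom a = 0 from h]; rfl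
  rw [PositiveLinearMap.gnsNonUnitalStarAlgHom_apply_coe] at h3
  have h4 := congrArg norm h3
  rw [UniformSpace.Completion.norm_coe, norm_zero] at h4
  have h5 := F.preGNS_norm_sq (F.leftMulMapPreGNS a (F.toPreGNS (star a)))
  rw [h4] at h5
  simpa using h5.symm

end Faithful

section Injective

variable {A B C : Type u} [NonUnitalCStarAlgebra A] [NonUnitalCStarAlgebra B]
  [NonUnitalCStarAlgebra C]

/-- A representation extended to multipliers kills the vectors that the algebra kills. -/
theorem repExt_apply_of_forall {H : Type*} [NormedAddCommGroup H] [InnerProductSpace ℂ H]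
    [CompleteSpace H] (π : A →⋆ₙₐ[ℂ] (H →L[ℂ] H)) (m : 𝓜(ℂ, A)) {y : H} (hy : ∀ a, π a y = 0) :
    repExt π m y = 0 :=
  (exists_repExt π m).choose_spec.2 y hy

theorem repExt_coe {H : Type*} [NormedAddCommGroup H] [InnerProductSpace ℂ H]
    [CompleteSpace H] (π : A →⋆ₙₐ[ℂ] (H →L[ℂ] H)) (a : A) : repExt π (a : 𝓜(ℂ, A)) = π a :=
  rep_op_ext π (fun b x => by simp [repExt_apply])
    (fun y hy => by rw [repExt_apply_of_forall π _ hy, hy])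

theorem prodRepHom_tmul (R : Rep A) (S : Rep B) (a : A) (b : B) :
    prodRepHom R S (tmul a b) = opTensor (R.π a) (S.π b) :=
  prodRepHom_ofAlg R S (a ⊗ₜ[ℂ] b)

/-- Operators on a Hilbert space tensor product agree if they agree on elementary tensors of vectors
each of which lies in the range of, or is killed by, an algebra of operators. -/
theorem op_ext_rep {H K E : Type*} [NormedAddCommGroup H] [InnerProductSpace ℂ H] [CompleteSpace H]
    [NormedAddCommGroup K] [InnerProductSpace ℂ K] [CompleteSpace K] [NormedAddCommGroup E]
    [NormedSpace ℂ E] (π : A →⋆ₙₐ[ℂ] (H →L[ℂ] H)) (σ : B →⋆ₙₐ[ℂ] (K →L[ℂ] K))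
    {S T : HilbertTensor H K →L[ℂ] E}
    (h : ∀ x y, ((∃ a x', π a x' = x) ∨ ∀ a, π a x = 0) → ((∃ b y', σ b y' = y) ∨ ∀ b, σ b y = 0) →
      S (hilbertEmb (x ⊗ₜ[ℂ] y)) = T (hilbertEmb (x ⊗ₜ[ℂ] y))) : S = T := by
  let L (x : H) : K →L[ℂ] HilbertTensor H K :=
    { toFun := fun y => hilbertEmb (x ⊗ₜ[ℂ] y)
      map_add' := fun y z => by rw [TensorProduct.tmul_add, map_add]
      map_smul' := fun c y => by rw [TensorProduct.tmul_smul, map_smul]; rfl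
      cont := hilbertEmb.continuous.comp
        (TensorProduct.continuous_tmul.comp (continuous_const.prodMk continuous_id)) }
  let L' (y : K) : H →L[ℂ] HilbertTensor H K :=
    { toFun := fun x => hilbertEmb (x ⊗ₜ[ℂ] y)
      map_add' := fun x z => by rw [TensorProduct.add_tmul, map_add]
      map_smul' := fun c x => by rw [← TensorProduct.smul_tmul', map_smul]; rfl
      cont := hilbertEmb.continuous.comp
        (TensorProduct.continuous_tmul.comp (continuous_id.prodMk continuous_const)) }
  refine op_ext fun x y => ?_
  have h1 : ∀ x, ((∃ a x', π a x' = x) ∨ ∀ a, π a x = 0) → S.comp (L x) = T.comp (L x) :=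
    fun x hx => ContinuousLinearMap.ext_on (dense_actionSpan_rep σ) fun y hy => h x y hx hy
  have h2 : S.comp (L' y) = T.comp (L' y) :=
    ContinuousLinearMap.ext_on (dense_actionSpan_rep π) fun x hx =>
      congrArg (fun φ : K →L[ℂ] E => φ y) (h1 x hx)
  exact congrArg (fun φ : H →L[ℂ] E => φ x) h2

/-- The extension of `π ⊗ σ` to multipliers sends `m ⊗ n` to `π(m) ⊗ σ(n)`, also for degenerate
`π` and `σ`: both sides vanish on the vectors that `π` or `σ` kills. -/
theorem repExt_prodRepHom_multTmul (R : Rep A) (S : Rep B) (m : 𝓜(ℂ, A)) (n : 𝓜(ℂ, B)) :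
    repExt (prodRepHom R S) (multTmul m n) = opTensor (repExt R.π m) (repExt S.π n) := by
  have hz : ∀ x y, (∀ a b, opTensor (R.π a) (S.π b) (hilbertEmb (x ⊗ₜ[ℂ] y)) = 0) →
      repExt (prodRepHom R S) (multTmul m n) (hilbertEmb (x ⊗ₜ[ℂ] y)) = 0 := by
    intro x y h
    refine repExt_apply_of_forall _ _ fun z => ?_
    refine tensor_fun_ext (F := fun z => prodRepHom R S z (hilbertEmb (x ⊗ₜ[ℂ] y)))
      (F' := fun _ => 0) ((star_hom_continuous (prodRepHom R S)).clm_apply continuous_const)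
      continuous_const (fun z w => by rw [map_add]; rfl) (fun _ _ => (add_zero 0).symm)
      (fun a b => ?_) z
    rw [prodRepHom_tmul, h]
  refine op_ext_rep R.π S.π fun x y hx hy => ?_
  rcases hx with ⟨a, x, rfl⟩ | hx
  · rcases hy with ⟨b, y, rfl⟩ | hy
    · rw [← opTensor_tmul, ← prodRepHom_tmul, repExt_apply, multTmul_fst_tmul, prodRepHom_tmul,
        prodRepHom_tmul, opTensor_tmul, opTensor_tmul, opTensor_tmul, repExt_apply, repExt_apply]
    · rw [hz _ _ fun a b => by rw [opTensor_tmul, hy, TensorProduct.tmul_zero, map_zero],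
        opTensor_tmul, repExt_apply_of_forall S.π n hy, TensorProduct.tmul_zero, map_zero]
  · rw [hz _ _ fun a b => by rw [opTensor_tmul, hx, TensorProduct.zero_tmul, map_zero],
      opTensor_tmul, repExt_apply_of_forall R.π m hx, TensorProduct.zero_tmul, map_zero]

theorem repExt_homTensor (R : Rep C) (S : Rep A) (f : B →⋆ₙₐ[ℂ] 𝓜(ℂ, A)) (x : C ⊗[ℂ] B) :
    repExt (prodRepHom R S) (homTensor DoubleCentralizer.coeHom f (ofAlg x)) =
      prodRep R.π ((repExt S.π).comp f) x := by
  induction x using TensorProduct.induction_on with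
  | zero => rw [map_zero, map_zero, map_zero, map_zero]
  | add x y hx hy => rw [map_add, map_add, map_add, map_add, hx, hy]
  | tmul c b =>
    change repExt (prodRepHom R S) (homTensor DoubleCentralizer.coeHom f (tmul c b)) = _
    rw [homTensor_tmul, repExt_prodRepHom_multTmul, prodRep_tmul]
    change opTensor (repExt R.π (c : 𝓜(ℂ, C))) _ = _
    rw [repExt_coe]
    rfl

/-- For an injective `f : B → M(A)` the map `id ⊗ f : C ⊗ B → M(C ⊗ A)` is isometric: the
representations of `B` that come from representations of `A` are jointly faithful, so they compute
the spatial norm. -/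
theorem norm_homTensor_coe {f : B →⋆ₙₐ[ℂ] 𝓜(ℂ, A)} (hf : Function.Injective f) (x : C ⊗ₛ B) :
    ‖homTensor DoubleCentralizer.coeHom f x‖ = ‖x‖ := by
  refine le_antisymm (NonUnitalStarAlgHom.norm_apply_le _ x) ?_
  choose T hT using fun a : {a : A // a ≠ 0} => exists_rep_ne_zero a.2
  have hfaith : ∀ b, (∀ i, ((repExt (T i).π).comp f) b = 0) → b = 0 := by
    intro b hb
    refine (injective_iff_map_eq_zero f).mp hf b (mult_ext fun a => ?_)
    by_contra ha
    refine hT ⟨(f b).fst a, ha⟩ (ContinuousLinearMap.ext fun x => ?_)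
    have h0 : repExt (T ⟨(f b).fst a, ha⟩).π (f b) = 0 := hb _
    rw [← repExt_apply, h0]
    rfl
  refine denseRange_ofAlg.induction_on
    (p := fun x => ‖x‖ ≤ ‖homTensor DoubleCentralizer.coeHom f x‖) x ?_ fun x => ?_
  · exact isClosed_le continuous_norm (star_hom_continuous (homTensor _ f)).norm
  · refine norm_ofAlg_le (norm_nonneg _) fun R S => ?_
    refine norm_prodRep_le_of_family R S (fun i => ⟨(T i).H, (repExt (T i).π).comp f⟩) hfaith x
      (norm_nonneg _) fun i => ?_
    rw [← repExt_homTensor]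
    exact NonUnitalStarAlgHom.norm_apply_le (repExt (prodRepHom R (T i))) _

end Injective

/-! ### Composition and tensor products of morphisms -/

section MorCategory

variable {A B C D A' B' C' D' E : Type u} [NonUnitalCStarAlgebra A] [NonUnitalCStarAlgebra B]
  [NonUnitalCStarAlgebra C] [NonUnitalCStarAlgebra D] [NonUnitalCStarAlgebra A']
  [NonUnitalCStarAlgebra B'] [NonUnitalCStarAlgebra C'] [NonUnitalCStarAlgebra D']
  [NonUnitalCStarAlgebra E]

theorem Mor.ext_hom {f g : Mor A B} (h : ∀ a, f.hom a = g.hom a) : f = g := by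
  obtain ⟨f, _⟩ := f
  obtain ⟨g, _⟩ := g
  obtain rfl : f = g := NonUnitalStarAlgHom.ext h
  rfl

theorem mul_coe (m : 𝓜(ℂ, A)) (a : A) : m * (a : 𝓜(ℂ, A)) = (m.fst a : A) := by
  refine mult_ext fun b => ?_
  simp only [DoubleCentralizer.mul_fst, mul_apply_eq_comp, DoubleCentralizer.coe_fst,
    ContinuousLinearMap.mul_apply']
  have : ∀ c : A, c * (m.fst (a * b) - m.fst a * b) = 0 := fun c => by
    rw [mul_sub, ← mul_assoc, ← m.central, ← m.central, mul_assoc, sub_self]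
  exact sub_eq_zero.mp (CStarRing.star_mul_self_eq_zero_iff _ |>.mp (this _))

/-- The multiplier `f(m)` is determined by `f(m) f(a) = f(m a)`. -/
theorem Mor.extend_eq_of_forall (f : Mor A B) {m : 𝓜(ℂ, A)} {n : 𝓜(ℂ, B)}
    (h : ∀ a, n * f.hom a = f.hom (m.fst a)) : f.extend m = n :=
  f.mult_ext fun a b => by
    rw [f.extend_apply, ← h, DoubleCentralizer.mul_fst, mul_apply_eq_comp]

theorem Mor.extend_mul_hom (f : Mor A B) (m : 𝓜(ℂ, A)) (a : A) :
    f.extend m * f.hom a = f.hom (m.fst a) := by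
  rw [← f.extend_coe, ← map_mul, mul_coe, f.extend_coe]

theorem Mor.extend_one (f : Mor A B) : f.extend 1 = 1 :=
  f.extend_eq_of_forall fun a => by rw [one_mul]; rfl

/-- This makes composition of morphisms associative. -/
theorem Mor.extend_comp (g : Mor B C) (f : Mor A B) (m : 𝓜(ℂ, A)) :
    (g.comp f).extend m = g.extend (f.extend m) :=
  Mor.extend_eq_of_forall _ fun a => by
    change g.extend (f.extend m) * g.extend (f.hom a) = g.extend (f.hom (m.fst a))
    rw [← map_mul, f.extend_mul_hom]

theorem Mor.comp_assoc (h : Mor C D) (g : Mor B C) (f : Mor A B) :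
    (h.comp g).comp f = h.comp (g.comp f) :=
  Mor.ext_hom fun a => h.extend_comp g (f.hom a)

theorem Mor.id_extend (m : 𝓜(ℂ, A)) : (Mor.id A).extend m = m :=
  Mor.extend_eq_of_forall _ fun a => mul_coe m a

theorem Mor.id_comp (f : Mor A B) : (Mor.id B).comp f = f :=
  Mor.ext_hom fun a => Mor.id_extend (f.hom a)

theorem Mor.comp_id (f : Mor A B) : f.comp (Mor.id A) = f :=
  Mor.ext_hom fun a => f.extend_coe a

/-- The extension of an injective morphism to multipliers is injective. -/
theorem Mor.extend_injective {f : Mor A B} (hf : Function.Injective f.hom) :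
    Function.Injective f.extend := by
  refine (injective_iff_map_eq_zero f.extend).mpr fun m hm =>
    QuantumCompactification.mult_ext fun a => ?_
  refine (injective_iff_map_eq_zero f.hom).mp hf _ ?_
  rw [← f.extend_mul_hom, hm, zero_mul]

/-- An injective morphism is a monomorphism. -/
theorem Mor.comp_left_cancel {f : Mor B C} (hf : Function.Injective f.hom) {g h : Mor A B}
    (H : f.comp g = f.comp h) : g = h :=
  Mor.ext_hom fun a => Mor.extend_injective hf
    (congrArg (fun k : Mor A C => k.hom a) H)

theorem multTmul_mul (m m' : 𝓜(ℂ, A)) (n n' : 𝓜(ℂ, B)) :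
    multTmul m n * multTmul m' n' = multTmul (m * m') (n * n') :=
  mult_tensor_ext fun a b => by
    simp only [DoubleCentralizer.mul_fst, mul_apply_eq_comp, multTmul_fst_tmul]

theorem multTmul_one : multTmul (1 : 𝓜(ℂ, A)) (1 : 𝓜(ℂ, B)) = 1 :=
  mult_tensor_ext fun a b => by rw [multTmul_fst_tmul]; rfl

theorem multTmul_coe (a : A) (b : B) :
    multTmul (a : 𝓜(ℂ, A)) (b : 𝓜(ℂ, B)) = (tmul a b : A ⊗ₛ B) :=
  mult_tensor_ext fun a' b' => by
    rw [multTmul_fst_tmul]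
    exact (tmul_mul_tmul a a' b b').symm

theorem Mor.tensor_hom_tmul (f : Mor A C) (g : Mor B D) (a : A) (b : B) :
    (f.tensor g).hom (tmul a b) = multTmul (f.hom a) (g.hom b) :=
  homTensor_tmul _ _ a b

theorem Mor.tensor_extend_multTmul (f : Mor A C) (g : Mor B D) (m : 𝓜(ℂ, A)) (n : 𝓜(ℂ, B)) :
    (f.tensor g).extend (multTmul m n) = multTmul (f.extend m) (g.extend n) := by
  refine Mor.extend_eq_of_forall _ fun z => ?_
  refine tensor_fun_ext (F := fun z => multTmul (f.extend m) (g.extend n) * (f.tensor g).hom z)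
    (F' := fun z => (f.tensor g).hom ((multTmul m n).fst z))
    (continuous_const.mul (star_hom_continuous _))
    ((star_hom_continuous _).comp (ContinuousLinearMap.continuous _))
    (fun x y => by rw [map_add, mul_add]) (fun x y => by rw [map_add, map_add]) (fun a b => ?_) z
  rw [Mor.tensor_hom_tmul, multTmul_mul, f.extend_mul_hom, g.extend_mul_hom, multTmul_fst_tmul,
    Mor.tensor_hom_tmul]

/-- Morphisms from a tensor product agree if they agree on elementary tensors. -/
theorem Mor.ext_tmul {f g : Mor (A ⊗ₛ B) C} (h : ∀ a b, f.hom (tmul a b) = g.hom (tmul a b)) :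
    f = g :=
  Mor.ext_hom fun z => tensor_fun_ext (star_hom_continuous f.hom) (star_hom_continuous g.hom)
    (map_add f.hom) (map_add g.hom) h z

theorem Mor.tensor_comp (f : Mor A B) (f' : Mor A' B') (g : Mor B C) (g' : Mor B' C') :
    (g.comp f).tensor (g'.comp f') = (g.tensor g').comp (f.tensor f') :=
  Mor.ext_tmul fun a b => by
    change _ = (g.tensor g').extend ((f.tensor f').hom (tmul a b))
    rw [Mor.tensor_hom_tmul, Mor.tensor_hom_tmul, Mor.tensor_extend_multTmul]
    rfl

theorem Mor.tensor_id : (Mor.id A).tensor (Mor.id B) = Mor.id (A ⊗ₛ B) :=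
  Mor.ext_tmul fun a b => by
    rw [Mor.tensor_hom_tmul]
    exact multTmul_coe a b

theorem Mor.assoc_extend_multTmul (m : 𝓜(ℂ, A)) (n : 𝓜(ℂ, B)) (k : 𝓜(ℂ, D)) :
    (Mor.assoc A B D).extend (multTmul (multTmul m n) k) = multTmul m (multTmul n k) := by
  refine Mor.extend_eq_of_forall _ fun z => ?_
  let S : (A ⊗ₛ B) ⊗ₛ D →L[ℂ] A ⊗ₛ (B ⊗ₛ D) :=
    (multTmul m (multTmul n k)).fst.comp (assocCLM A B D)
  let T : (A ⊗ₛ B) ⊗ₛ D →L[ℂ] A ⊗ₛ (B ⊗ₛ D) :=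
    (assocCLM A B D).comp (multTmul (multTmul m n) k).fst
  have hST : S = T := tensor_ext₃ fun a b d => by
    change (multTmul m (multTmul n k)).fst (assocCLM A B D _) =
      assocCLM A B D ((multTmul (multTmul m n) k).fst _)
    rw [assocCLM_tmul, multTmul_fst_tmul, multTmul_fst_tmul, multTmul_fst_tmul, multTmul_fst_tmul,
      assocCLM_tmul]
  have hz : S z = T z := congrArg (fun φ : (A ⊗ₛ B) ⊗ₛ D →L[ℂ] A ⊗ₛ (B ⊗ₛ D) => φ z) hST
  exact (mul_coe _ _).trans (congrArg DoubleCentralizer.coeHom hz)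

theorem Mor.assoc_naturality (f : Mor A A') (g : Mor B B') (h : Mor D D') :
    (Mor.assoc A' B' D').comp ((f.tensor g).tensor h) =
      (f.tensor (g.tensor h)).comp (Mor.assoc A B D) := by
  refine Mor.ext_hom fun z => ?_
  let S : (A ⊗ₛ B) ⊗ₛ D →L[ℂ] 𝓜(ℂ, A' ⊗ₛ (B' ⊗ₛ D')) :=
    { toLinearMap := (((Mor.assoc A' B' D').comp ((f.tensor g).tensor h)).hom : _ →ₗ[ℂ] _)
      cont := star_hom_continuous _ }
  let T : (A ⊗ₛ B) ⊗ₛ D →L[ℂ] 𝓜(ℂ, A' ⊗ₛ (B' ⊗ₛ D')) :=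
    { toLinearMap := (((f.tensor (g.tensor h)).comp (Mor.assoc A B D)).hom : _ →ₗ[ℂ] _)
      cont := star_hom_continuous _ }
  have hST : S = T := tensor_ext₃ fun a b d => by
    change (Mor.assoc A' B' D').extend (((f.tensor g).tensor h).hom _) =
      (f.tensor (g.tensor h)).extend ((Mor.assoc A B D).hom _)
    rw [Mor.assoc_hom_tmul, Mor.extend_coe, Mor.tensor_hom_tmul, Mor.tensor_hom_tmul,
      Mor.tensor_hom_tmul, Mor.tensor_hom_tmul, Mor.assoc_extend_multTmul]
  exact congrArg (fun φ : (A ⊗ₛ B) ⊗ₛ D →L[ℂ] 𝓜(ℂ, A' ⊗ₛ (B' ⊗ₛ D')) => φ z) hST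

theorem Mor.id_tensor_injective {f : Mor A B} (hf : Function.Injective f.hom) :
    Function.Injective ((Mor.id C).tensor f).hom := by
  refine (injective_iff_map_eq_zero ((Mor.id C).tensor f).hom).mpr fun x hx => ?_
  rw [← norm_eq_zero, ← norm_homTensor_coe hf x, norm_eq_zero]
  exact hx

end MorCategory

/-! ### Podleś subsets of the multiplier algebra -/

section Podles

variable {G : LCQG.{u}} {A : Type u} [NonUnitalCStarAlgebra A]

theorem continuous_multTmul_right {C : Type u} [NonUnitalCStarAlgebra C] (m : 𝓜(ℂ, C)) :
    Continuous fun n : 𝓜(ℂ, A) => multTmul m n := by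
  simp only [← multTensor_tmul]
  exact (star_hom_continuous multTensor).comp (continuous_tmul_right m)

/-- A continuous linear map that sends a set into a closed subspace sends its closed linear span
there. -/
theorem map_mem_of_mem_closure_span {E F : Type*} [NormedAddCommGroup E] [NormedSpace ℂ E]
    [NormedAddCommGroup F] [NormedSpace ℂ F] {s : Set E} {V : Submodule ℂ F}
    (hV : IsClosed (V : Set F)) (L : E →L[ℂ] F) (h : ∀ x ∈ s, L x ∈ V) {x : E}
    (hx : x ∈ (Submodule.span ℂ s).topologicalClosure) : L x ∈ V :=
  Submodule.topologicalClosure_minimal (Submodule.span ℂ s)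
    (t := V.comap (L : E →ₗ[ℂ] F)) (Submodule.span_le.mpr h) (hV.preimage L.continuous) hx

theorem multTmul_add_right {C : Type u} [NonUnitalCStarAlgebra C] (m : 𝓜(ℂ, C)) (n n' : 𝓜(ℂ, A)) :
    multTmul m (n + n') = multTmul m n + multTmul m n' := by
  simp only [← multTensor_tmul, tmul_add_right, map_add]

theorem multTmul_smul_right {C : Type u} [NonUnitalCStarAlgebra C] (c : ℂ) (m : 𝓜(ℂ, C))
    (n : 𝓜(ℂ, A)) : multTmul m (c • n) = c • multTmul m n := by
  simp only [← multTensor_tmul, tmul_smul_right, map_smul]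

/-- The closed linear span of `C₀(G) ⊗ S` in `M(C₀(G) ⊗ A)`, for `S ⊆ M(A)`. -/
noncomputable def tensorSpan (G : LCQG.{u}) (S : Set 𝓜(ℂ, A)) : Submodule ℂ 𝓜(ℂ, G.C ⊗ₛ A) :=
  (Submodule.span ℂ {y | ∃ c : G.C, ∃ s ∈ S, multTmul (c : 𝓜(ℂ, G.C)) s = y}).topologicalClosure

/-- The closed linear span of `ρ(S)(C₀(G) ⊗ 1)` in `M(C₀(G) ⊗ A)`, for `S ⊆ M(A)`. -/
noncomputable def actionTensorSpan (ρ : QuantumAction G A) (S : Set 𝓜(ℂ, A)) :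
    Submodule ℂ 𝓜(ℂ, G.C ⊗ₛ A) :=
  (Submodule.span ℂ
    {y | ∃ c : G.C, ∃ s ∈ S, ρ.mor.extend s * G.leg A c = y}).topologicalClosure

/-- The Podleś condition for a set `S` of multipliers: `ρ(S)(C₀(G) ⊗ 1)` and `C₀(G) ⊗ S` have the
same closed linear span. A unital C*-subalgebra of `M(A)` with this property is one on which `ρ`
restricts to an action. -/
def IsPodles (ρ : QuantumAction G A) (S : Set 𝓜(ℂ, A)) : Prop :=
  actionTensorSpan ρ S = tensorSpan G S

theorem isClosed_tensorSpan (S : Set 𝓜(ℂ, A)) :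
    IsClosed (tensorSpan G S : Set 𝓜(ℂ, G.C ⊗ₛ A)) :=
  Submodule.isClosed_topologicalClosure _

theorem isClosed_actionTensorSpan (ρ : QuantumAction G A) (S : Set 𝓜(ℂ, A)) :
    IsClosed (actionTensorSpan ρ S : Set 𝓜(ℂ, G.C ⊗ₛ A)) :=
  Submodule.isClosed_topologicalClosure _

theorem multTmul_mem_tensorSpan {S : Set 𝓜(ℂ, A)} {s : 𝓜(ℂ, A)} (hs : s ∈ S) (c : G.C) :
    multTmul (c : 𝓜(ℂ, G.C)) s ∈ tensorSpan G S :=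
  Submodule.le_topologicalClosure _ (Submodule.subset_span ⟨c, s, hs, rfl⟩)

theorem extend_mul_leg_mem_actionTensorSpan (ρ : QuantumAction G A) {S : Set 𝓜(ℂ, A)}
    {s : 𝓜(ℂ, A)} (hs : s ∈ S) (c : G.C) :
    ρ.mor.extend s * G.leg A c ∈ actionTensorSpan ρ S :=
  Submodule.le_topologicalClosure _ (Submodule.subset_span ⟨c, s, hs, rfl⟩)

theorem tensorSpan_mono {S T : Set 𝓜(ℂ, A)} (h : S ⊆ T) : tensorSpan G S ≤ tensorSpan G T :=
  Submodule.topologicalClosure_mono (Submodule.span_mono fun _ ⟨c, s, hs, e⟩ => ⟨c, s, h hs, e⟩)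

theorem actionTensorSpan_mono (ρ : QuantumAction G A) {S T : Set 𝓜(ℂ, A)} (h : S ⊆ T) :
    actionTensorSpan ρ S ≤ actionTensorSpan ρ T :=
  Submodule.topologicalClosure_mono (Submodule.span_mono fun _ ⟨c, s, hs, e⟩ => ⟨c, s, h hs, e⟩)

/-- The Podleś condition, elementwise: `ρ(s)(c ⊗ 1)` lies in the closed span of `C₀(G) ⊗ S`,
and `c ⊗ s` in that of `ρ(S)(C₀(G) ⊗ 1)`. -/
theorem isPodles_iff (ρ : QuantumAction G A) (S : Set 𝓜(ℂ, A)) :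
    IsPodles ρ S ↔ ∀ s ∈ S, ∀ c : G.C, ρ.mor.extend s * G.leg A c ∈ tensorSpan G S ∧
      multTmul (c : 𝓜(ℂ, G.C)) s ∈ actionTensorSpan ρ S := by
  constructor
  · intro h s hs c
    exact ⟨h ▸ extend_mul_leg_mem_actionTensorSpan ρ hs c, h ▸ multTmul_mem_tensorSpan hs c⟩
  · intro h
    refine le_antisymm (Submodule.topologicalClosure_minimal _ (Submodule.span_le.mpr ?_)
      (isClosed_tensorSpan S)) (Submodule.topologicalClosure_minimal _
        (Submodule.span_le.mpr ?_) (isClosed_actionTensorSpan ρ S))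
    · rintro _ ⟨c, s, hs, rfl⟩
      exact (h s hs c).1
    · rintro _ ⟨c, s, hs, rfl⟩
      exact (h s hs c).2

variable {D : StarSubalgebra ℂ 𝓜(ℂ, A)}

theorem multTmul_eq_leg_mul (c : G.C) (n : 𝓜(ℂ, A)) :
    multTmul (c : 𝓜(ℂ, G.C)) n = G.leg A c * multTmul 1 n := by
  rw [LCQG.leg, multTmul_mul, mul_one, one_mul]

theorem mul_multTmul_one_mem_tensorSpan {n : 𝓜(ℂ, A)} (hn : n ∈ D) {x : 𝓜(ℂ, G.C ⊗ₛ A)}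
    (hx : x ∈ tensorSpan G (D : Set 𝓜(ℂ, A))) :
    x * multTmul 1 n ∈ tensorSpan G (D : Set 𝓜(ℂ, A)) := by
  refine map_mem_of_mem_closure_span (isClosed_tensorSpan _)
    ((ContinuousLinearMap.mul ℂ 𝓜(ℂ, G.C ⊗ₛ A)).flip (multTmul 1 n)) ?_ hx
  rintro _ ⟨c, s, hs, rfl⟩
  change multTmul (c : 𝓜(ℂ, G.C)) s * multTmul 1 n ∈ _
  rw [multTmul_mul, mul_one]
  exact multTmul_mem_tensorSpan (mul_mem hs hn) c

/-- Since `c ⊗ s = (c ⊗ 1)(1 ⊗ s)`, it suffices to know the products `ρ(d)(c ⊗ 1)`. -/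
theorem extend_mul_mem_tensorSpan {ρ : QuantumAction G A} {d : 𝓜(ℂ, A)}
    (h : ∀ c : G.C, ρ.mor.extend d * G.leg A c ∈ tensorSpan G (D : Set 𝓜(ℂ, A)))
    {x : 𝓜(ℂ, G.C ⊗ₛ A)} (hx : x ∈ tensorSpan G (D : Set 𝓜(ℂ, A))) :
    ρ.mor.extend d * x ∈ tensorSpan G (D : Set 𝓜(ℂ, A)) := by
  refine map_mem_of_mem_closure_span (isClosed_tensorSpan _)
    (ContinuousLinearMap.mul ℂ 𝓜(ℂ, G.C ⊗ₛ A) (ρ.mor.extend d)) ?_ hx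
  rintro _ ⟨c, s, hs, rfl⟩
  change ρ.mor.extend d * multTmul (c : 𝓜(ℂ, G.C)) s ∈ _
  rw [multTmul_eq_leg_mul, ← mul_assoc]
  exact mul_multTmul_one_mem_tensorSpan hs (h c)

theorem extend_mul_mem_actionTensorSpan {ρ : QuantumAction G A} {d : 𝓜(ℂ, A)} (hd : d ∈ D)
    {x : 𝓜(ℂ, G.C ⊗ₛ A)} (hx : x ∈ actionTensorSpan ρ (D : Set 𝓜(ℂ, A))) :
    ρ.mor.extend d * x ∈ actionTensorSpan ρ (D : Set 𝓜(ℂ, A)) := by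
  refine map_mem_of_mem_closure_span (isClosed_actionTensorSpan ρ _)
    (ContinuousLinearMap.mul ℂ 𝓜(ℂ, G.C ⊗ₛ A) (ρ.mor.extend d)) ?_ hx
  rintro _ ⟨c, s, hs, rfl⟩
  change ρ.mor.extend d * (ρ.mor.extend s * G.leg A c) ∈ _
  rw [← mul_assoc, ← map_mul]
  exact extend_mul_leg_mem_actionTensorSpan ρ (mul_mem hd hs) c

/-- Since `(c ⊗ 1)(1 ⊗ n) = c ⊗ n`, it suffices to know that `C₀(G) ⊗ n` lies in the closed span. -/
theorem mul_multTmul_one_mem_actionTensorSpan {ρ : QuantumAction G A} {n : 𝓜(ℂ, A)}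
    (h : ∀ c : G.C, multTmul (c : 𝓜(ℂ, G.C)) n ∈ actionTensorSpan ρ (D : Set 𝓜(ℂ, A)))
    {x : 𝓜(ℂ, G.C ⊗ₛ A)} (hx : x ∈ actionTensorSpan ρ (D : Set 𝓜(ℂ, A))) :
    x * multTmul 1 n ∈ actionTensorSpan ρ (D : Set 𝓜(ℂ, A)) := by
  refine map_mem_of_mem_closure_span (isClosed_actionTensorSpan ρ _)
    ((ContinuousLinearMap.mul ℂ 𝓜(ℂ, G.C ⊗ₛ A)).flip (multTmul 1 n)) ?_ hx
  rintro _ ⟨c, s, hs, rfl⟩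
  change ρ.mor.extend s * G.leg A c * multTmul 1 n ∈ _
  rw [mul_assoc, ← multTmul_eq_leg_mul]
  exact extend_mul_mem_actionTensorSpan hs (h c)

/-- The unital C*-algebra generated by a family of self-adjoint sets with the Podleś condition has
the Podleś condition. -/
theorem IsPodles.topologicalClosure_adjoin {ρ : QuantumAction G A} {𝒮 : Set (Set 𝓜(ℂ, A))}
    (h𝒮 : ∀ S ∈ 𝒮, star S = S ∧ IsPodles ρ S) :
    IsPodles ρ ((StarAlgebra.adjoin ℂ (⋃₀ 𝒮)).topologicalClosure : Set 𝓜(ℂ, A)) := by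
  set D := (StarAlgebra.adjoin ℂ (⋃₀ 𝒮)).topologicalClosure with hD
  have hsub : ∀ S ∈ 𝒮, S ⊆ (D : Set 𝓜(ℂ, A)) := fun S hS x hx =>
    StarSubalgebra.le_topologicalClosure _ (StarAlgebra.subset_adjoin ℂ _ ⟨S, hS, hx⟩)
  have hstar : ⋃₀ 𝒮 ∪ star (⋃₀ 𝒮) = ⋃₀ 𝒮 := by
    refine Set.union_eq_left.mpr fun x hx => ?_
    obtain ⟨S, hS, hx⟩ := Set.mem_star.mp hx
    exact ⟨S, hS, (h𝒮 S hS).1 ▸ Set.mem_star.mpr hx⟩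
  have key : ∀ x ∈ StarAlgebra.adjoin ℂ (⋃₀ 𝒮), x ∈ D ∧ ∀ c : G.C,
      ρ.mor.extend x * G.leg A c ∈ tensorSpan G (D : Set 𝓜(ℂ, A)) ∧
      multTmul (c : 𝓜(ℂ, G.C)) x ∈ actionTensorSpan ρ (D : Set 𝓜(ℂ, A)) := by
    intro x hx
    have hx' : x ∈ Algebra.adjoin ℂ (⋃₀ 𝒮) := hstar ▸ hx
    refine ⟨StarSubalgebra.le_topologicalClosure _ hx, ?_⟩
    clear hx
    induction hx' using Algebra.adjoin_induction with
    | mem x hx =>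
      obtain ⟨S, hS, hxS⟩ := hx
      intro c
      obtain ⟨h1, h2⟩ := (isPodles_iff ρ S).mp (h𝒮 S hS).2 x hxS c
      exact ⟨tensorSpan_mono (hsub S hS) h1, actionTensorSpan_mono ρ (hsub S hS) h2⟩
    | algebraMap r =>
      intro c
      have h1 : algebraMap ℂ 𝓜(ℂ, A) r ∈ D := algebraMap_mem D r
      have h2 : ρ.mor.extend (algebraMap ℂ 𝓜(ℂ, A) r) * G.leg A c =
          multTmul (c : 𝓜(ℂ, G.C)) (algebraMap ℂ 𝓜(ℂ, A) r) := by
        rw [multTmul_eq_leg_mul, Algebra.algebraMap_eq_smul_one, map_smul, Mor.extend_one,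
          multTmul_smul_right, multTmul_one, smul_mul_assoc, one_mul, mul_smul_comm, mul_one]
      exact ⟨h2 ▸ multTmul_mem_tensorSpan h1 c, h2 ▸ extend_mul_leg_mem_actionTensorSpan ρ h1 c⟩
    | add x y hx hy h1 h2 =>
      intro c
      rw [map_add, add_mul, multTmul_add_right]
      exact ⟨add_mem (h1 c).1 (h2 c).1, add_mem (h1 c).2 (h2 c).2⟩
    | mul x y hx hy h1 h2 =>
      intro c
      have hxy : multTmul (c : 𝓜(ℂ, G.C)) (x * y) =
          multTmul (c : 𝓜(ℂ, G.C)) x * multTmul 1 y := by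
        rw [multTmul_mul, mul_one]
      rw [map_mul, mul_assoc, hxy]
      exact ⟨extend_mul_mem_tensorSpan (fun c => (h1 c).1) (h2 c).1,
        mul_multTmul_one_mem_actionTensorSpan (fun c => (h2 c).2) (h1 c).2⟩
  refine (isPodles_iff ρ _).mpr fun x hx c => ?_
  constructor
  · refine closure_minimal (t := {x | ρ.mor.extend x * G.leg A c ∈
      tensorSpan G (D : Set 𝓜(ℂ, A))}) (fun x hx => ((key x hx).2 c).1)
      ((isClosed_tensorSpan _).preimage ?_) hx
    exact (star_hom_continuous ρ.mor.extend).mul continuous_const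
  · exact closure_minimal (t := {x | multTmul (c : 𝓜(ℂ, G.C)) x ∈
      actionTensorSpan ρ (D : Set 𝓜(ℂ, A))}) (fun x hx => ((key x hx).2 c).2)
      ((isClosed_actionTensorSpan ρ _).preimage (continuous_multTmul_right _)) hx

/-- `(id ⊗ f)(y)` lies in the closed linear span of `C₀(G) ⊗ f(B)`. -/
theorem idTensor_mem_tensorSpan {B : Type u} [NonUnitalCStarAlgebra B] (f : B →⋆ₙₐ[ℂ] 𝓜(ℂ, A))
    (y : G.C ⊗ₛ B) : G.idTensor f y ∈ tensorSpan G (Set.range f) := by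
  refine denseRange_ofAlg.induction_on (p := fun y => G.idTensor f y ∈ tensorSpan G (Set.range f)) y
    ((isClosed_tensorSpan _).preimage (star_hom_continuous (G.idTensor f))) fun x => ?_
  induction x using TensorProduct.induction_on with
  | zero => rw [map_zero, map_zero]; exact zero_mem _
  | add x y hx hy => rw [map_add, map_add]; exact add_mem hx hy
  | tmul c b =>
    change homTensor DoubleCentralizer.coeHom f (tmul c b) ∈ _
    rw [homTensor_tmul]
    exact multTmul_mem_tensorSpan (Set.mem_range_self b) c

/-- The image of an action under an equivariant `*`-homomorphism to multipliers has the Podleś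
condition. -/
theorem IsEquivariant.isPodles_range {B : Type u} [NonUnitalCStarAlgebra B]
    {ρB : QuantumAction G B} {ρ : QuantumAction G A} {f : B →⋆ₙₐ[ℂ] 𝓜(ℂ, A)}
    (hf : IsEquivariant ρB ρ f) : IsPodles ρ (Set.range f) := by
  refine (isPodles_iff ρ _).mpr ?_
  rintro _ ⟨b, rfl⟩ c
  constructor
  · obtain ⟨y, hy⟩ := ρB.mul_leg_mem b c
    rw [hf b c y hy]
    exact idTensor_mem_tensorSpan f y
  · let L : G.C ⊗ₛ B →L[ℂ] 𝓜(ℂ, G.C ⊗ₛ A) :=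
      { toLinearMap := (G.idTensor f : _ →ₗ[ℂ] _)
        cont := star_hom_continuous _ }
    have h1 : L (tmul c b) ∈ actionTensorSpan ρ (Set.range f) := by
      refine map_mem_of_mem_closure_span (isClosed_actionTensorSpan ρ _) L ?_ (ρB.dense (tmul c b))
      rintro y ⟨b, c, hy⟩
      change G.idTensor f y ∈ _
      rw [← hf b c y hy]
      exact extend_mul_leg_mem_actionTensorSpan ρ (Set.mem_range_self b) c
    have h2 : L (tmul c b) = multTmul (c : 𝓜(ℂ, G.C)) (f b) :=
      homTensor_tmul DoubleCentralizer.coeHom f c b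
    exact h2 ▸ h1

/-- The canonical inclusion of an algebra with an action into its multipliers is equivariant. -/
theorem isEquivariant_coeHom (ρ : QuantumAction G A) :
    IsEquivariant ρ ρ DoubleCentralizer.coeHom :=
  IsEquivariantHom.id ρ

end Podles

/-! ### Restriction of multipliers to an embedded C*-algebra -/

section Restrict

variable {P Q : Type*} [NonUnitalCStarAlgebra P] [CStarAlgebra Q]

theorem star_hom_isometry {J : P →⋆ₙₐ[ℂ] Q} (hJ : Function.Injective J) : Isometry J :=
  AddMonoidHomClass.isometry_of_norm J fun x => NonUnitalStarAlgHom.norm_map J hJ x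

/-- The operator `y ↦ J⁻¹(m J(y))` on a C*-algebra `P` embedded by `J` in a unital C*-algebra, for
`m` with `m J(P) ⊆ J(P)`. -/
theorem exists_restrict_mul {J : P →⋆ₙₐ[ℂ] Q} (hJ : Function.Injective J) {m : Q}
    (hm : ∀ y, ∃ z, J z = m * J y) : ∃ L : P →L[ℂ] P, ∀ y, J (L y) = m * J y := by
  choose F hF using hm
  refine ⟨LinearMap.mkContinuous
    { toFun := F
      map_add' := fun x y => hJ (by rw [hF, map_add, map_add, hF, hF, mul_add])
      map_smul' := fun c x => hJ (by
        rw [hF, map_smul, RingHom.id_apply, map_smul, hF, mul_smul_comm]) } ‖m‖ fun x => ?_, hF⟩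
  change ‖F x‖ ≤ ‖m‖ * ‖x‖
  rw [← NonUnitalStarAlgHom.norm_map J hJ (F x), ← NonUnitalStarAlgHom.norm_map J hJ x, hF]
  exact norm_mul_le _ _

/-- If a C*-algebra `P` is embedded by `J` in a unital C*-algebra and `θ(B) J(P) ⊆ J(P)`, then `θ`
induces a `*`-homomorphism `B → M(P)`. -/
theorem exists_restrict_hom {B : Type*} [NonUnitalCStarAlgebra B] {J : P →⋆ₙₐ[ℂ] Q}
    (hJ : Function.Injective J) (θ : B →⋆ₙₐ[ℂ] Q) (hθ : ∀ b y, ∃ z, J z = θ b * J y) :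
    ∃ X : B →⋆ₙₐ[ℂ] 𝓜(ℂ, P), ∀ b y, J ((X b).fst y) = θ b * J y := by
  choose L hL using fun b => exists_restrict_mul hJ (hθ b)
  let F (b : B) : 𝓜(ℂ, P) := mkMult (L b) (L (star b)) fun x y => hJ (by
    rw [map_mul, map_mul, map_star, map_star, hL, hL, map_star, star_mul, mul_assoc])
  have hF : ∀ b y, J ((F b).fst y) = θ b * J y := hL
  refine ⟨{ toFun := F
            map_smul' := fun c b => mult_ext fun y => hJ ?_
            map_zero' := mult_ext fun y => hJ ?_
            map_add' := fun b b' => mult_ext fun y => hJ ?_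
            map_mul' := fun b b' => mult_ext fun y => hJ ?_
            map_star' := fun b => mult_ext fun y => ?_ }, hF⟩
  · rw [hF, map_smul, smul_mul_assoc, ← hF, ← map_smul]
    rfl
  · rw [hF, map_zero, zero_mul]
    exact (map_zero J).symm
  · rw [hF, map_add, add_mul, ← hF, ← hF, ← map_add]
    rfl
  · rw [hF, map_mul, mul_assoc, ← hF, ← hF]
    rfl
  -- the right action of `F b` was chosen as the adjoint of the left action of `F (star b)`
  · rw [DoubleCentralizer.star_fst]
    change L (star b) y = star (star (L (star b) (star (star y))))
    rw [star_star, star_star]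

end Restrict

theorem homTensor_tensorMap {A B C E : Type u} [NonUnitalCStarAlgebra A] [NonUnitalCStarAlgebra B]
    [NonUnitalCStarAlgebra C] [NonUnitalCStarAlgebra E] (f : B →⋆ₙₐ[ℂ] 𝓜(ℂ, A))
    (g : E →⋆ₙₐ[ℂ] B) (y : C ⊗ₛ E) :
    homTensor DoubleCentralizer.coeHom f (tensorMap (NonUnitalStarAlgHom.id ℂ C) g y) =
      homTensor DoubleCentralizer.coeHom (f.comp g) y := by
  have h := tensorMap_comp (DoubleCentralizer.coeHom (𝕜 := ℂ)) (NonUnitalStarAlgHom.id ℂ C) f g y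
  exact congrArg multTensor h.symm

/-! ### The action on a Podleś subalgebra -/

section RestrictAction

variable {G : LCQG.{u}} {A : Type u} [NonUnitalCStarAlgebra A]
variable (D : StarSubalgebra ℂ 𝓜(ℂ, A)) [hD : IsClosed (D : Set 𝓜(ℂ, A))]

/-- The inclusion of a unital C*-subalgebra of `M(A)`, as a non-degenerate morphism from it
to `A`. -/
noncomputable def inclMor : Mor D A where
  hom := (D.subtype : D →⋆ₙₐ[ℂ] 𝓜(ℂ, A))
  nondegenerate := by
    have h : {y : A | ∃ (d : D) (a : A),
        ((D.subtype : D →⋆ₙₐ[ℂ] 𝓜(ℂ, A)) d).fst a = y} = Set.univ :=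
      Set.eq_univ_of_forall fun a => ⟨1, a, rfl⟩
    rw [h, Submodule.span_univ]
    exact dense_univ

theorem inclMor_injective : Function.Injective (inclMor D).hom :=
  Subtype.val_injective

variable (G) in
/-- The embedding `C₀(G) ⊗ D → M(C₀(G) ⊗ A)` as a morphism. -/
noncomputable def idInclMor : Mor (G.C ⊗ₛ D) (G.C ⊗ₛ A) :=
  (Mor.id G.C).tensor (inclMor D)

theorem idInclMor_injective : Function.Injective (idInclMor G D).hom :=
  Mor.id_tensor_injective (inclMor_injective D)

theorem idInclMor_tmul (c : G.C) (d : D) :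
    (idInclMor G D).hom (tmul c d) = multTmul (c : 𝓜(ℂ, G.C)) (d : 𝓜(ℂ, A)) :=
  Mor.tensor_hom_tmul _ _ _ _

theorem idInclMor_extend_leg (c : G.C) :
    (idInclMor G D).extend (G.leg D c) = G.leg A c := by
  rw [LCQG.leg, idInclMor, Mor.tensor_extend_multTmul, Mor.id_extend, Mor.extend_one, LCQG.leg]

theorem idInclMor_mem_tensorSpan (y : G.C ⊗ₛ D) :
    (idInclMor G D).hom y ∈ tensorSpan G (D : Set 𝓜(ℂ, A)) := by
  have h := idTensor_mem_tensorSpan (D.subtype : D →⋆ₙₐ[ℂ] 𝓜(ℂ, A)) y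
  exact tensorSpan_mono (by rintro _ ⟨d, rfl⟩; exact d.2) h

/-- The image of `C₀(G) ⊗ D` in `M(C₀(G) ⊗ A)` is closed, because the embedding is isometric. -/
theorem exists_idInclMor_eq {x : 𝓜(ℂ, G.C ⊗ₛ A)}
    (hx : x ∈ tensorSpan G (D : Set 𝓜(ℂ, A))) : ∃ y, (idInclMor G D).hom y = x := by
  have hcl : IsClosed (Set.range (idInclMor G D).hom) :=
    (star_hom_isometry (idInclMor_injective D)).isClosedEmbedding.isClosed_range
  refine Submodule.topologicalClosure_minimal _
    (t := LinearMap.range ((idInclMor G D).hom : (G.C ⊗ₛ D) →ₗ[ℂ] 𝓜(ℂ, G.C ⊗ₛ A)))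
    (Submodule.span_le.mpr ?_) hcl hx
  rintro _ ⟨c, d, hd, rfl⟩
  exact ⟨tmul c ⟨d, hd⟩, idInclMor_tmul D c ⟨d, hd⟩⟩

variable {D} {ρ : QuantumAction G A}

theorem exists_idInclMor_eq_extend_mul (hρ : IsPodles ρ (D : Set 𝓜(ℂ, A))) (d : D) (y : G.C ⊗ₛ D) :
    ∃ z, (idInclMor G D).hom z = (ρ.mor.extend.comp (inclMor D).hom) d * (idInclMor G D).hom y :=
  exists_idInclMor_eq D (extend_mul_mem_tensorSpan
    (fun c => ((isPodles_iff ρ _).mp hρ d d.2 c).1) (idInclMor_mem_tensorSpan D y))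

/-- A set that contains preimages of all `ρ(d)(c ⊗ 1)` has dense span in `C₀(G) ⊗ D`. -/
theorem dense_span_of_extend_mul_leg (hρ : IsPodles ρ (D : Set 𝓜(ℂ, A))) {s : Set (G.C ⊗ₛ D)}
    (hs : ∀ (c : G.C) (d : D), ∃ y ∈ s, (idInclMor G D).hom y = ρ.mor.extend d * G.leg A c) :
    Dense (Submodule.span ℂ s : Set (G.C ⊗ₛ D)) := by
  intro z
  rw [(star_hom_isometry (idInclMor_injective D)).isUniformInducing.isInducing
    |>.closure_eq_preimage_closure_image]
  have hz : (idInclMor G D).hom z ∈ actionTensorSpan ρ (D : Set 𝓜(ℂ, A)) :=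
    hρ ▸ idInclMor_mem_tensorSpan D z
  have hle : Submodule.span ℂ {y | ∃ c : G.C, ∃ d ∈ (D : Set 𝓜(ℂ, A)),
      ρ.mor.extend d * G.leg A c = y} ≤
      (Submodule.span ℂ s).map ((idInclMor G D).hom : (G.C ⊗ₛ D) →ₗ[ℂ] 𝓜(ℂ, G.C ⊗ₛ A)) := by
    refine Submodule.span_le.mpr ?_
    rintro _ ⟨c, d, hd, rfl⟩
    obtain ⟨y, hy, e⟩ := hs c ⟨d, hd⟩
    exact ⟨y, Submodule.subset_span hy, e⟩
  exact closure_mono hle hz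

variable (hρ : IsPodles ρ (D : Set 𝓜(ℂ, A)))

/-- The morphism `D → M(C₀(G) ⊗ D)` obtained by restricting an action to a subalgebra with the
Podleś condition. -/
noncomputable def restrictMor : Mor D (G.C ⊗ₛ D) where
  hom := (exists_restrict_hom (idInclMor_injective D) _ (exists_idInclMor_eq_extend_mul hρ)).choose
  nondegenerate := by
    refine dense_span_of_extend_mul_leg hρ fun c d => ⟨_, ⟨d, tmul c 1, rfl⟩, ?_⟩
    rw [(exists_restrict_hom (idInclMor_injective D) _
      (exists_idInclMor_eq_extend_mul hρ)).choose_spec d, idInclMor_tmul]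
    rfl

theorem idInclMor_restrictMor_fst (d : D) (y : G.C ⊗ₛ D) :
    (idInclMor G D).hom (((restrictMor hρ).hom d).fst y) =
      ρ.mor.extend d * (idInclMor G D).hom y :=
  (exists_restrict_hom (idInclMor_injective D) _
    (exists_idInclMor_eq_extend_mul hρ)).choose_spec d y

theorem idInclMor_extend_restrictMor (d : D) :
    (idInclMor G D).extend ((restrictMor hρ).hom d) = ρ.mor.extend d :=
  Mor.extend_eq_of_forall _ fun y => (idInclMor_restrictMor_fst hρ d y).symm

/-- The inclusion intertwines the restricted morphism with `ρ`, in the category of morphisms. -/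
theorem idInclMor_comp_restrictMor :
    (idInclMor G D).comp (restrictMor hρ) = ρ.mor.comp (inclMor D) :=
  Mor.ext_hom fun d => idInclMor_extend_restrictMor hρ d

theorem idInclMor_extend_mul_leg (d : D) (c : G.C) :
    (idInclMor G D).extend ((restrictMor hρ).hom d * G.leg D c) =
      ρ.mor.extend d * G.leg A c := by
  rw [map_mul, idInclMor_extend_restrictMor, idInclMor_extend_leg]

theorem restrictMor_mul_leg_eq_iff (d : D) (c : G.C) (y : G.C ⊗ₛ D) :
    (restrictMor hρ).hom d * G.leg D c = (y : 𝓜(ℂ, G.C ⊗ₛ D)) ↔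
      (idInclMor G D).hom y = ρ.mor.extend d * G.leg A c := by
  rw [← (Mor.extend_injective (idInclMor_injective (G := G) D)).eq_iff, idInclMor_extend_mul_leg,
    Mor.extend_coe]
  exact eq_comm

theorem exists_restrictMor_mul_leg (d : D) (c : G.C) : ∃ y : G.C ⊗ₛ D,
    (restrictMor hρ).hom d * G.leg D c = (y : 𝓜(ℂ, G.C ⊗ₛ D)) := by
  obtain ⟨y, hy⟩ := exists_idInclMor_eq D ((isPodles_iff ρ _).mp hρ d d.2 c).1
  exact ⟨y, (restrictMor_mul_leg_eq_iff hρ d c y).mpr hy⟩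

theorem LCQG.star_leg (B : Type u) [NonUnitalCStarAlgebra B] (c : G.C) :
    star (G.leg B c) = G.leg B (star c) := by
  rw [LCQG.leg, ← star_multTmul, star_one, LCQG.leg]
  congr 1
  exact (map_star (DoubleCentralizer.coeHom : G.C →⋆ₙₐ[ℂ] 𝓜(ℂ, G.C)) c).symm

/-- Coassociativity is inherited from `ρ`, because `id ⊗ id ⊗ ι` is a monomorphism for the
inclusion `ι` of the subalgebra. -/
theorem restrictMor_coassoc : ((Mor.id G.C).tensor (restrictMor hρ)).comp (restrictMor hρ) =
    (Mor.assoc G.C G.C D).comp ((G.Δ.tensor (Mor.id D)).comp (restrictMor hρ)) := by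
  refine Mor.comp_left_cancel (f := (Mor.id G.C).tensor (idInclMor G D))
    (Mor.id_tensor_injective (idInclMor_injective D)) ?_
  have h1 : ((Mor.id G.C).tensor (idInclMor G D)).comp ((Mor.id G.C).tensor (restrictMor hρ)) =
      ((Mor.id G.C).tensor ρ.mor).comp (idInclMor G D) := by
    rw [← Mor.tensor_comp, idInclMor_comp_restrictMor, Mor.tensor_comp]
    rfl
  have h2 : ((Mor.id G.C).tensor (idInclMor G D)).comp (Mor.assoc G.C G.C D) =
      (Mor.assoc G.C G.C A).comp ((Mor.id (G.C ⊗ₛ G.C)).tensor (inclMor D)) := by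
    rw [← Mor.tensor_id, Mor.assoc_naturality]
    rfl
  have h3 : ((Mor.id (G.C ⊗ₛ G.C)).tensor (inclMor D)).comp (G.Δ.tensor (Mor.id D)) =
      (G.Δ.tensor (Mor.id A)).comp (idInclMor G D) := by
    rw [idInclMor, ← Mor.tensor_comp, ← Mor.tensor_comp, Mor.id_comp, Mor.comp_id, Mor.id_comp,
      Mor.comp_id]
  calc ((Mor.id G.C).tensor (idInclMor G D)).comp
        (((Mor.id G.C).tensor (restrictMor hρ)).comp (restrictMor hρ))
      = ((Mor.id G.C).tensor ρ.mor).comp (ρ.mor.comp (inclMor D)) := by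
        rw [← Mor.comp_assoc, h1, Mor.comp_assoc, idInclMor_comp_restrictMor]
    _ = (Mor.assoc G.C G.C A).comp ((G.Δ.tensor (Mor.id A)).comp (ρ.mor.comp (inclMor D))) := by
        rw [← Mor.comp_assoc, ρ.coassoc, Mor.comp_assoc, Mor.comp_assoc]
    _ = (Mor.assoc G.C G.C A).comp ((((Mor.id (G.C ⊗ₛ G.C)).tensor (inclMor D)).comp
        (G.Δ.tensor (Mor.id D))).comp (restrictMor hρ)) := by
        rw [h3, Mor.comp_assoc, idInclMor_comp_restrictMor]
    _ = ((Mor.id G.C).tensor (idInclMor G D)).comp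
        ((Mor.assoc G.C G.C D).comp ((G.Δ.tensor (Mor.id D)).comp (restrictMor hρ))) := by
        rw [← Mor.comp_assoc ((Mor.id G.C).tensor (idInclMor G D)), h2, Mor.comp_assoc,
          Mor.comp_assoc]

/-- An action restricted to a unital C*-subalgebra of `M(A)` with the Podleś condition. -/
noncomputable def restrictAction : QuantumAction G D where
  mor := restrictMor hρ
  coassoc := restrictMor_coassoc hρ
  mul_leg_mem := exists_restrictMor_mul_leg hρ
  leg_mul_mem d c := by
    obtain ⟨y, hy⟩ := exists_restrictMor_mul_leg hρ (star d) (star c)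
    refine ⟨star y, ?_⟩
    have := congrArg star hy
    rw [star_mul, map_star, star_star, LCQG.star_leg, star_star] at this
    rw [this]
    exact (map_star (DoubleCentralizer.coeHom : G.C ⊗ₛ D →⋆ₙₐ[ℂ] 𝓜(ℂ, G.C ⊗ₛ D)) y).symm
  dense := dense_span_of_extend_mul_leg hρ fun c d => by
    obtain ⟨y, hy⟩ := exists_restrictMor_mul_leg hρ d c
    exact ⟨y, ⟨d, c, hy⟩, (restrictMor_mul_leg_eq_iff hρ d c y).mp hy⟩

theorem isEquivariant_subtype :
    IsEquivariant (restrictAction hρ) ρ (D.subtype : D →⋆ₙₐ[ℂ] 𝓜(ℂ, A)) :=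
  fun d c y h => ((restrictMor_mul_leg_eq_iff hρ d c y).mp h).symm

/-- A `*`-homomorphism into the subalgebra is equivariant if it is so as a map into `M(A)`. -/
theorem isEquivariantHom_of_coe {B : Type u} [NonUnitalCStarAlgebra B] {ρB : QuantumAction G B}
    {f : B →⋆ₙₐ[ℂ] 𝓜(ℂ, A)} (hf : IsEquivariant ρB ρ f) (g : B →⋆ₙₐ[ℂ] D)
    (hg : ∀ b, (g b : 𝓜(ℂ, A)) = f b) : IsEquivariantHom ρB (restrictAction hρ) g := by
  refine (isEquivariantHom_iff _ _ _).mpr fun b c y h => ?_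
  refine (restrictMor_mul_leg_eq_iff hρ (g b) c _).mpr ?_
  have hfg : (inclMor D).hom.comp g = f := NonUnitalStarAlgHom.ext hg
  rw [hg, hf b c y h, ← hfg]
  exact homTensor_tensorMap (inclMor D).hom g y

end RestrictAction

/-! ### The greatest equivariant compactification -/

section Greatest

variable {G : LCQG.{u}} {A : Type u} [NonUnitalCStarAlgebra A] (ρ : QuantumAction G A)

/-- The greatest unital C*-subalgebra of `M(A)` with the Podleś condition: the one generated by all
self-adjoint sets with that condition. -/
noncomputable def greatestPodles : StarSubalgebra ℂ 𝓜(ℂ, A) :=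
  (StarAlgebra.adjoin ℂ (⋃₀ {S | star S = S ∧ IsPodles ρ S})).topologicalClosure

instance : IsClosed (greatestPodles ρ : Set 𝓜(ℂ, A)) :=
  StarSubalgebra.isClosed_topologicalClosure _

theorem isPodles_greatestPodles : IsPodles ρ (greatestPodles ρ : Set 𝓜(ℂ, A)) :=
  IsPodles.topologicalClosure_adjoin fun _ h => h

variable {ρ}

theorem IsEquivariant.apply_mem_greatestPodles {B : Type u} [NonUnitalCStarAlgebra B]
    {ρB : QuantumAction G B} {f : B →⋆ₙₐ[ℂ] 𝓜(ℂ, A)} (hf : IsEquivariant ρB ρ f) (b : B) :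
    f b ∈ greatestPodles ρ := by
  refine StarSubalgebra.le_topologicalClosure _ (StarAlgebra.subset_adjoin ℂ _
    ⟨Set.range f, ⟨?_, hf.isPodles_range⟩, b, rfl⟩)
  ext x
  rw [Set.mem_star]
  constructor
  · rintro ⟨b, hb⟩
    exact ⟨star b, by rw [map_star, hb, star_star]⟩
  · rintro ⟨b, rfl⟩
    exact ⟨star b, map_star f b⟩

variable (ρ)

/-- The equivariant compactification on the greatest unital C*-subalgebra of `M(A)` with the Podleś
condition. -/
noncomputable def greatestCompactification : EquivariantCompactification ρ where
  B := greatestPodles ρ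
  ℓ :=
    { toFun := fun a => ⟨a, (isEquivariant_coeHom ρ).apply_mem_greatestPodles a⟩
      map_smul' := fun c a => Subtype.ext (map_smul DoubleCentralizer.coeHom c a)
      map_zero' := Subtype.ext (map_zero DoubleCentralizer.coeHom)
      map_add' := fun a b => Subtype.ext (map_add DoubleCentralizer.coeHom a b)
      map_mul' := fun a b => Subtype.ext (map_mul DoubleCentralizer.coeHom a b)
      map_star' := fun a => Subtype.ext (map_star DoubleCentralizer.coeHom a) }
  r := (greatestPodles ρ).subtype
  r_ℓ _ := rfl
  ρB := restrictAction (isPodles_greatestPodles ρ)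
  equivariant_ℓ := isEquivariantHom_of_coe _ (isEquivariant_coeHom ρ) _ fun _ => rfl
  equivariant_r := isEquivariant_subtype _
  equivariant_incl := isEquivariant_coeHom ρ

theorem greatestCompactification_r_injective :
    Function.Injective (greatestCompactification ρ).r :=
  Subtype.val_injective

variable {ρ}

/-- The morphism to the greatest compactification: the map to `M(A)`, corestricted. -/
noncomputable def toGreatest (X : EquivariantCompactification ρ) :
    X ⟶ greatestCompactification ρ :=
  EquivariantCompactification.Hom.mk (Y := greatestCompactification ρ)
    (StarAlgHom.codRestrict X.r (greatestPodles ρ) X.equivariant_r.apply_mem_greatestPodles)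
    (fun a => Subtype.ext (X.r_ℓ a)) (fun _ => rfl)
    (isEquivariantHom_of_coe _ X.equivariant_r _ fun _ => rfl)

theorem hom_greatestCompactification_unique {X : EquivariantCompactification ρ}
    (f g : X ⟶ greatestCompactification ρ) : f = g :=
  EquivariantCompactification.Hom.ext (StarAlgHom.ext fun b =>
    greatestCompactification_r_injective ρ ((f.r_f b).trans (g.r_f b).symm))

end Greatest

end QuantumCompactification

theorem mainTheorem1 (G : QuantumCompactification.LCQG.{u}) (A : Type u) [NonUnitalCStarAlgebra A]
    (ρ : QuantumCompactification.QuantumAction G A) :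
    CategoryTheory.Limits.HasTerminal (QuantumCompactification.EquivariantCompactification ρ) :=
  (CategoryTheory.Limits.IsTerminal.ofUniqueHom QuantumCompactification.toGreatest fun _ f =>
    QuantumCompactification.hom_greatestCompactification_unique f _).hasTerminal
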